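/- **Notation.** Let $j,k\ge 1$ and $n$ be integers with $j+k<n$. Let $G(n,j)$ be the set of affine $j$-planes $\tau=\xi+u$ in $\mathbb R^n$ ($\xi$ a $j$-dimensional linear subspace, $u\in\xi^\perp$), $|\tau|=|u|$ its distance to the origin, and $d\tau=d\xi\,du$, where $d\xi$ is the $O(n)$-invariant probability measure on the Grassmannian and $du$ is the Euclidean volume on $\xi^\perp$. For $\zeta=\eta+v\in G(n,k)$ set $$(R_{j,k}f)(\zeta)=\int_{G_j(\eta^\perp)}d\xi\int_\eta f(\xi+u+v)\,du ,$$ where $G_j(\eta^\perp)$ is the Grassmannian of $j$-dimensional linear subspaces of $\eta^\perp$ with its invariant probability measure. On $(0,\infty)$ let, for $\alpha>0$, $$(I^\alpha_{+,2}g)(t)=\frac{2}{\Gamma(\alpha)}\int_0^t (t^2-r^2)^{\alpha-1}g(r)\,r\,dr,\qquad (I^\alpha_{-,2}g)(t)=\frac{2}{\Gamma(\alpha)}\int_t^\infty (r^2-t^2)^{\alpha-1}g(r)\,r\,dr,$$ and let $D=\frac1{2t}\frac{d}{dt}$. With $m=[\alpha]$, the Erdélyi–Kober fractional derivatives are $$\mathcal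 D^\alpha_{+,2}\varphi=D^{m+1}I^{1-\alpha+m}_{+,2}\varphi;\qquad \mathcal D^\alpha_{-,2}\varphi=(-D)^m\varphi\ \text{ if }\alpha=m,\qquad \mathcal D^\alpha_{-,2}\varphi=t^{2(1-\alpha+m)}(-D)^{m+1}t^{2\alpha}I^{1-\alpha+m}_{-,2}t^{-2m-2}\varphi\ \text{ if }\alpha\notin\mathbb Z;$$ in particular $\mathcal D^{k/2}_{-,2}\varphi=t(-D)^{(k+1)/2}t^kI^{1/2}_{-,2}t^{-k-1}\varphi$ for odd $k$. Finally let $$(I_{j,k}f_0)(s)=\tilde c_1\,s^{k+2-n}\,(I^{j/2}_{+,2}\,r^{n-j-k-2}\,I^{k/2}_{-,2}f_0)(s),\qquad \tilde c_1=\frac{\pi^{k/2}\,\Gamma((n-k)/2)}{\Gamma((n-j-k)/2)}.$$ **Theorem.** Let $f(\tau)=f_0(|\tau|)$ be a complex-valued locally integrable radial function on $G(n,j)$ such that $$\int_{|\tau|>a}|f(\tau)|\,|\tau|^{k+j-n}\,d\tau<\infty\quad\text{for some }a>0 .$$ Then, for almost all $\zeta\in G(n,k)$, the integral $(R_{j,k}f)(\zeta)$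 exists in the Lebesgue sense and $(R_{j,k}f)(\zeta)=(I_{j,k}f_0)(|\zeta|)$; the fractional integrals $I^{k/2}_{-,2}f_0$ and $I^{j/2}_{+,2}r^{n-j-k-2}I^{k/2}_{-,2}f_0$ converge absolutely almost everywhere on $(0,\infty)$; and $f_0$ is recovered from $R_{j,k}f$ by the formula $$f_0(t)=\tilde c_1^{-1}\,\bigl(\mathcal D^{k/2}_{-,2}\,r^{2-n+j+k}\,\mathcal D^{j/2}_{+,2}\,s^{n-k-2}\,I_{j,k}f_0\bigr)(t)\qquad\text{for almost all }t>0 .$$ In this formula the integrals inside the fractional derivatives converge absolutely for every $t>0$; in each of the two fractional derivatives, every application of $D$ but the last is to a function differentiable at every point of $(0,\infty)$, and the last one to a function differentiable almost everywhere. -/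

import Mathlib

open MeasureTheory Set

noncomputable section

namespace MixedRadon

/-! ## Grassmannians, affine Grassmannians and their invariant measures -/

section Grassmannians

variable (X : Type*) [NormedAddCommGroup X] [InnerProductSpace ℝ X]

/-- The Grassmannian of `j`-dimensional linear subspaces of `X`. -/
def Gr (j : ℕ) : Type _ := {ξ : Submodule ℝ X // Module.finrank ℝ ξ = j}

/-- The affine Grassmannian of `j`-dimensional affine planes in `X`. The plane `τ = ξ + u` is
given by the pair `(ξ, u)`, where `ξ` is its direction and `u ∈ ξᗮ` is its point closest to the
origin. -/
def AffGr (j : ℕ) : Type _ :=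
  {p : Submodule ℝ X × X // Module.finrank ℝ p.1 = j ∧ p.2 ∈ p.1ᗮ}

variable {X}

/-- The direction `ξ` of the plane `ξ + u`. -/
def AffGr.dir {j : ℕ} (τ : AffGr X j) : Submodule ℝ X := τ.1.1

/-- The point `u ∈ ξᗮ` of the plane `ξ + u` closest to the origin. -/
def AffGr.foot {j : ℕ} (τ : AffGr X j) : X := τ.1.2

/-- The Euclidean distance `|τ|` between the plane `τ` and the origin. -/
def AffGr.dist0 {j : ℕ} (τ : AffGr X j) : ℝ := ‖τ.foot‖

variable [FiniteDimensional ℝ X]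

/-- The plane `ξ + x` through the point `x` parallel to the `j`-dimensional subspace `ξ`. -/
def AffGr.through {j : ℕ} (ξ : Gr X j) (x : X) : AffGr X j :=
  ⟨(ξ.1, (ξ.1ᗮ).starProjection x), ξ.2, Submodule.starProjection_apply_mem _ x⟩

/-- The topology of the Grassmannian: subspaces are identified with orthogonal projections. -/
instance (j : ℕ) : TopologicalSpace (Gr X j) :=
  TopologicalSpace.induced (fun ξ : Gr X j => (ξ.1.starProjection : X →L[ℝ] X)) inferInstance

instance (j : ℕ) : MeasurableSpace (Gr X j) := borel _

instance (j : ℕ) : BorelSpace (Gr X j) := ⟨rfl⟩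

/-- The topology of the affine Grassmannian as a bundle over the Grassmannian. -/
instance (j : ℕ) : TopologicalSpace (AffGr X j) :=
  TopologicalSpace.induced
    (fun τ : AffGr X j => ((τ.dir.starProjection : X →L[ℝ] X), τ.foot)) inferInstance

instance (j : ℕ) : MeasurableSpace (AffGr X j) := borel _

instance (j : ℕ) : BorelSpace (AffGr X j) := ⟨rfl⟩

variable (X) [CompleteSpace X]

/-- The orthogonal group of `X`. -/
abbrev Orth : Type _ := unitary (X →L[ℝ] X)

instance : CompactSpace (Orth X) := by
  suffices hc : IsCompact ((unitary (X →L[ℝ] X) : Submonoid (X →L[ℝ] X)) : Set (X →L[ℝ] X)) from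
    isCompact_iff_compactSpace.mp hc
  refine Metric.isCompact_of_isClosed_isBounded ?_ ?_
  · have h : ((unitary (X →L[ℝ] X) : Submonoid (X →L[ℝ] X)) : Set (X →L[ℝ] X)) =
        {T | star T * T = 1} ∩ {T | T * star T = 1} := by
      ext T
      exact Unitary.mem_iff
    rw [h]
    exact (isClosed_eq (by fun_prop) continuous_const).inter
      (isClosed_eq (by fun_prop) continuous_const)
  · refine (Metric.isBounded_closedBall (x := (0 : X →L[ℝ] X)) (r := 1)).subset ?_
    intro T hT
    rw [mem_closedBall_zero_iff]
    refine T.opNorm_le_bound zero_le_one fun x => ?_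
    rw [one_mul]
    exact (Unitary.norm_map ⟨T, hT⟩ x).le

/-- The invariant (Haar) probability measure on the orthogonal group. -/
def orthHaar : Measure (Orth X) := Measure.haarMeasure ⊤

variable {X}

/-- The action of the orthogonal group on the Grassmannian. -/
def Gr.rotate {j : ℕ} (γ : Orth X) (ξ : Gr X j) : Gr X j :=
  ⟨ξ.1.map (Unitary.linearIsometryEquiv γ).toLinearEquiv.toLinearMap,
    (LinearEquiv.finrank_map_eq _ _).trans ξ.2⟩

/-- The action of the orthogonal group on affine planes. -/
def AffGr.rotate {j : ℕ} (γ : Orth X) (τ : AffGr X j) : AffGr X j :=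
  AffGr.through (Gr.rotate γ ⟨τ.dir, τ.2.1⟩) ((γ : X →L[ℝ] X) τ.foot)

variable (X)

open Classical in
/-- The standard probability measure `dξ` on the Grassmannian: the image of the Haar measure under
`γ ↦ γ ξ₀`, for some (equivalently, any) base point `ξ₀`. -/
def grMeasure (j : ℕ) : Measure (Gr X j) :=
  if h : Nonempty (Gr X j) then (orthHaar X).map (fun γ => Gr.rotate γ h.some) else 0

variable [MeasurableSpace X] [BorelSpace X]

open Classical in
/-- The measure `dτ = dξ du` on the affine Grassmannian, `dξ` being the standard probability
measure on the Grassmannian and `du` the Euclidean volume on `ξᗮ`: the image of the measure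
`dγ du` on `O(X) × ξ₀ᗮ` under `(γ, u) ↦ γ (ξ₀ + u)`, for some (equivalently, any) `ξ₀`. -/
def affGrMeasure (j : ℕ) : Measure (AffGr X j) :=
  if h : Nonempty (Gr X j) then
    ((orthHaar X).prod (volume : Measure ((h.some.1)ᗮ : Submodule ℝ X))).map
      (fun p => AffGr.rotate p.1 (AffGr.through h.some (p.2 : X)))
  else 0

end Grassmannians

/-! ## The mixed `j`-plane to `k`-plane Radon transform -/

section Radon

variable {X : Type*} [NormedAddCommGroup X] [InnerProductSpace ℝ X] [FiniteDimensional ℝ X]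
  [CompleteSpace X] [MeasurableSpace X] [BorelSpace X]

/-- A subspace of a subspace, viewed in the ambient space. -/
def Gr.lift {j : ℕ} {Y : Submodule ℝ X} (ξ : Gr Y j) : Gr X j :=
  ⟨ξ.1.map Y.subtype, (Submodule.finrank_map_subtype_eq _ _).trans ξ.2⟩

/-- The integral of `f` over all `j`-planes perpendicular to the `k`-plane `ζ = η + v` and meeting
it: `∫_{ξ ∈ G_j(ηᗮ)} ∫_{u ∈ η} f(ξ + u + v) du dξ`. -/
def radon {j k : ℕ} (f : AffGr X j → ℂ) (ζ : AffGr X k) : ℂ :=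
  ∫ ξ : Gr (ζ.dirᗮ : Submodule ℝ X) j,
    ∫ u : ζ.dir, f (AffGr.through ξ.lift ((u : X) + ζ.foot)) ∂volume ∂(grMeasure _ j)

/-- The integral defining `radon f ζ` exists in the Lebesgue sense. -/
def RadonExists {j k : ℕ} (f : AffGr X j → ℂ) (ζ : AffGr X k) : Prop :=
  Integrable (fun p : Gr (ζ.dirᗮ : Submodule ℝ X) j × ζ.dir =>
    f (AffGr.through p.1.lift ((p.2 : X) + ζ.foot))) ((grMeasure _ j).prod volume)

end Radon

/-! ## Erdélyi–Kober fractional integrals and derivatives -/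

/-- `(I^α_{+,2} f)(t) = 2/Γ(α) ∫_0^t (t² - r²)^{α-1} f(r) r dr`. -/
def ekPlus (α : ℝ) (f : ℝ → ℂ) (t : ℝ) : ℂ :=
  (2 / Real.Gamma α) • ∫ r in Ioc 0 t, ((t ^ 2 - r ^ 2) ^ (α - 1) * r) • f r

/-- `(I^α_{-,2} f)(t) = 2/Γ(α) ∫_t^∞ (r² - t²)^{α-1} f(r) r dr`. -/
def ekMinus (α : ℝ) (f : ℝ → ℂ) (t : ℝ) : ℂ :=
  (2 / Real.Gamma α) • ∫ r in Ioi t, ((r ^ 2 - t ^ 2) ^ (α - 1) * r) • f r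

/-- The integral `(I^α_{+,2} f)(t)` exists in the Lebesgue sense. -/
def EKPlusExists (α : ℝ) (f : ℝ → ℂ) (t : ℝ) : Prop :=
  IntegrableOn (fun r : ℝ => ((t ^ 2 - r ^ 2) ^ (α - 1) * r) • f r) (Ioc 0 t)

/-- The integral `(I^α_{-,2} f)(t)` exists in the Lebesgue sense. -/
def EKMinusExists (α : ℝ) (f : ℝ → ℂ) (t : ℝ) : Prop :=
  IntegrableOn (fun r : ℝ => ((r ^ 2 - t ^ 2) ^ (α - 1) * r) • f r) (Ioi t)

/-- The operator `D = (1 / 2t) d/dt`. -/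
def ekD (F : ℝ → ℂ) (t : ℝ) : ℂ := (1 / (2 * t)) • deriv F t

/-- `D^N F` is meaningful almost everywhere on `(0, ∞)`: all derivatives but the last one exist at
every point of `(0, ∞)`, and the last one exists almost everywhere. -/
def EKDExists (N : ℕ) (F : ℝ → ℂ) : Prop :=
  (∀ i, i + 1 < N → ∀ t : ℝ, 0 < t → DifferentiableAt ℝ (ekD^[i] F) t) ∧
  (∀ i, i < N → ∀ᵐ t : ℝ ∂(volume.restrict (Ioi 0)), DifferentiableAt ℝ (ekD^[i] F) t)

/-- `𝒟^α_{+,2} φ = D^{m+1} I^{1-α₀}_{+,2} φ`, where `α = m + α₀`, `m = [α]`. -/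
def ekDerivPlus (α : ℝ) (φ : ℝ → ℂ) : ℝ → ℂ :=
  ekD^[⌊α⌋₊ + 1] (ekPlus (1 - (α - ⌊α⌋₊)) φ)

/-- `𝒟^α_{+,2} φ` is meaningful almost everywhere on `(0, ∞)`. -/
def EKDerivPlusExists (α : ℝ) (φ : ℝ → ℂ) : Prop :=
  (∀ t : ℝ, 0 < t → EKPlusExists (1 - (α - ⌊α⌋₊)) φ t) ∧
  EKDExists (⌊α⌋₊ + 1) (ekPlus (1 - (α - ⌊α⌋₊)) φ)

open Classical in
/-- The fractional derivative `𝒟^α_{-,2} φ`. With `m = [α]`, it is `(-D)^m φ` if `α = m`, and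
`t^{2(1-α+m)} (-D)^{m+1} t^{2α} I^{1-α+m}_{-,2} t^{-2m-2} φ` otherwise. For `α = k/2` with `k` odd
the latter is `t (-D)^{(k+1)/2} t^k I^{1/2}_{-,2} t^{-k-1} φ`. -/
def ekDerivMinus (α : ℝ) (φ : ℝ → ℂ) (t : ℝ) : ℂ :=
  if α = ⌊α⌋₊ then (-1) ^ ⌊α⌋₊ * ekD^[⌊α⌋₊] φ t
  else (t ^ (2 * (1 - α + ⌊α⌋₊))) • ((-1) ^ (⌊α⌋₊ + 1) * ekD^[⌊α⌋₊ + 1]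
    (fun s : ℝ => (s ^ (2 * α)) •
      ekMinus (1 - α + ⌊α⌋₊) (fun r : ℝ => (r ^ (-2 * (⌊α⌋₊ : ℝ) - 2)) • φ r) s) t)

/-- `𝒟^α_{-,2} φ` is meaningful almost everywhere on `(0, ∞)`. -/
def EKDerivMinusExists (α : ℝ) (φ : ℝ → ℂ) : Prop :=
  (α = ⌊α⌋₊ → EKDExists ⌊α⌋₊ φ) ∧
  (α ≠ ⌊α⌋₊ →
    (∀ t : ℝ, 0 < t →
      EKMinusExists (1 - α + ⌊α⌋₊) (fun r : ℝ => (r ^ (-2 * (⌊α⌋₊ : ℝ) - 2)) • φ r) t) ∧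
    EKDExists (⌊α⌋₊ + 1) (fun s : ℝ => (s ^ (2 * α)) •
      ekMinus (1 - α + ⌊α⌋₊) (fun r : ℝ => (r ^ (-2 * (⌊α⌋₊ : ℝ) - 2)) • φ r) s))

/-! ## The mixed Radon transform of radial functions -/

/-- `c̃₁ = π^{k/2} Γ((n-k)/2) / Γ((n-j-k)/2)`. -/
def cTilde (n j k : ℕ) : ℝ :=
  Real.pi ^ ((k : ℝ) / 2) * Real.Gamma (((n : ℝ) - k) / 2) / Real.Gamma (((n : ℝ) - j - k) / 2)

/-- The inner function `r^{n-j-k-2} (I^{k/2}_{-,2} f₀)(r)` of the profile. -/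
def innerProfile (n j k : ℕ) (f₀ : ℝ → ℂ) (r : ℝ) : ℂ :=
  (r ^ ((n : ℤ) - j - k - 2)) • ekMinus ((k : ℝ) / 2) f₀ r

/-- `(I_{j,k} f₀)(s) = c̃₁ s^{-(n-k-2)} (I^{j/2}_{+,2} r^{n-j-k-2} I^{k/2}_{-,2} f₀)(s)`. -/
def profile (n j k : ℕ) (f₀ : ℝ → ℂ) (s : ℝ) : ℂ :=
  (cTilde n j k / s ^ ((n : ℤ) - k - 2)) • ekPlus ((j : ℝ) / 2) (innerProfile n j k f₀) s

/-- The function `s^{n-k-2} (I_{j,k} f₀)(s)`. -/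
def stepOne (n j k : ℕ) (f₀ : ℝ → ℂ) (s : ℝ) : ℂ :=
  (s ^ ((n : ℤ) - k - 2)) • profile n j k f₀ s

/-- The function `r^{2-n+j+k} (𝒟^{j/2}_{+,2} s^{n-k-2} I_{j,k} f₀)(r)`. -/
def stepTwo (n j k : ℕ) (f₀ : ℝ → ℂ) (r : ℝ) : ℂ :=
  (r ^ (2 - (n : ℤ) + j + k)) • ekDerivPlus ((j : ℝ) / 2) (stepOne n j k f₀) r

end MixedRadon

end

open MeasureTheory Set

noncomputable section

namespace MixedRadon

open ProbabilityTheory (beta beta_pos)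

set_option linter.unusedSectionVars false

/-! ### Beta integrals -/

/-! For a radial function the problem is one-dimensional. Let `ζ = η + v` with `|v| = s`, take `ξ ⊂
ηᗮ` and `u ∈ η`, and let `r` be the distance from `v` to `ξ`. By Pythagoras the plane `ξ + u + v`
has distance `√(|u|² + r²)` from the origin (`dist0_through_lift`). Polar coordinates in `η` turn
the integral over `u` into `π^{k/2} (I^{k/2}_{-,2} f₀)(r)` (`integral_plane`). For a random `ξ` the
distance `r` has a density proportional to `s^{2-N} r^{N-j-1} (s² - r²)^{j/2-1}` on `(0, s)`, where
`N = n - k` (`map_grMeasure`). This is the kernel of `I^{j/2}_{+,2} r^{n-j-k-2}`, and the constants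
combine to `c̃₁` (`pi_rpow_mul_distDensity`). Hence the transform is `I_{j,k} f₀`.

Local integrability and the condition at infinity say that `r^{n-j-1} f₀` is integrable near `0` and
`r^{k-1} f₀` away from `0` (`RadialIntegrable`). The main estimate, `RadialIntegrable.inner_aux`,
deduces that `x^{n-j-k-1} I^{k/2}_{-,2} f₀` is integrable on every `(0, S]`; the almost everywhere
convergence of both fractional integrals follows.

The inversion rests on composition rules, each of which is Fubini's theorem and a Beta integral. A
fractional integral is completed to integer order and then undone by powers of `D`, the last
application being Lebesgue's differentiation theorem. On the left side, `I^β_{+,2} I^α_{+,2} =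
I^{α+β}_{+,2}` (`ekPlus_comp`). On the right side an even `k` needs no completion. For odd `k` the
rule `I^{1/2}_{-,2} I^{k/2}_{-,2} = I^{(k+1)/2}_{-,2}` would require `r^k f₀` to be integrable at
infinity, one power too many; the weighted rule `t^k I^{1/2}_{-,2} x^{-k-1} I^{k/2}_{-,2} f₀ =
I^{(k+1)/2}_{-,2} r^{-1} f₀` (`ekMinus_half_weighted`) gains that power. -/

theorem lintegral_beta {α β : ℝ} (hα : 0 < α) (hβ : 0 < β) :
    ∫⁻ u in Ioo (0 : ℝ) 1, ENNReal.ofReal (u ^ (α - 1) * (1 - u) ^ (β - 1)) =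
      ENNReal.ofReal (beta α β) := by
  have hB := beta_pos hα hβ
  have h := ProbabilityTheory.lintegral_betaPDF_eq_one hα hβ
  rw [ProbabilityTheory.lintegral_betaPDF] at h
  simp_rw [mul_assoc, ENNReal.ofReal_mul (one_div_pos.2 hB).le] at h
  rw [lintegral_const_mul _ (by fun_prop)] at h
  have h1 : ENNReal.ofReal (beta α β) * ENNReal.ofReal (1 / beta α β) = 1 := by
    rw [← ENNReal.ofReal_mul hB.le, mul_one_div_cancel hB.ne', ENNReal.ofReal_one]
  calc _ = ENNReal.ofReal (beta α β) * (ENNReal.ofReal (1 / beta α β) *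
        ∫⁻ u in Ioo (0 : ℝ) 1, ENNReal.ofReal (u ^ (α - 1) * (1 - u) ^ (β - 1))) := by
        rw [← mul_assoc, h1, one_mul]
    _ = _ := by rw [h, mul_one]

/-- Beta integral after a strictly monotone substitution `u`. -/
theorem lintegral_beta_subst {α β p q : ℝ} (hα : 0 < α) (hβ : 0 < β) {u u' : ℝ → ℝ}
    (hu : ∀ x ∈ Ioo p q, HasDerivAt u (u' x) x) (hu' : ∀ x ∈ Ioo p q, 0 ≤ u' x)
    (hinj : InjOn u (Ioo p q)) (himg : u '' Ioo p q = Ioo 0 1) {F : ℝ → ℝ} {c : ℝ} (hc : 0 ≤ c)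
    (hF : ∀ x ∈ Ioo p q, F x = c * (u' x * (u x ^ (α - 1) * (1 - u x) ^ (β - 1)))) :
    ∫⁻ x in Ioo p q, ENNReal.ofReal (F x) = ENNReal.ofReal (beta α β * c) := by
  have h := lintegral_image_eq_lintegral_abs_deriv_mul measurableSet_Ioo
    (fun x hx => (hu x hx).hasDerivWithinAt) hinj
    (fun u => ENNReal.ofReal (u ^ (α - 1) * (1 - u) ^ (β - 1)))
  rw [himg, lintegral_beta hα hβ] at h
  rw [mul_comm, ENNReal.ofReal_mul hc, h, ← lintegral_const_mul' _ _ ENNReal.ofReal_ne_top]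
  refine setLIntegral_congr_fun measurableSet_Ioo fun x hx => ?_
  rw [hF x hx, ENNReal.ofReal_mul hc, ENNReal.ofReal_mul (hu' x hx), abs_of_nonneg (hu' x hx)]

theorem image_Ioo_of_strictMonoOn {u : ℝ → ℝ} {p q : ℝ} (hpq : p < q)
    (hmono : StrictMonoOn u (Icc p q)) (hcont : ContinuousOn u (Icc p q)) :
    u '' Ioo p q = Ioo (u p) (u q) := by
  refine Subset.antisymm ?_ (intermediate_value_Ioo hpq.le hcont)
  rintro _ ⟨x, hx, rfl⟩
  exact ⟨hmono (left_mem_Icc.2 hpq.le) (Ioo_subset_Icc_self hx) hx.1,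
    hmono (Ioo_subset_Icc_self hx) (right_mem_Icc.2 hpq.le) hx.2⟩

/-- The substitution `u = (x² - p²) / (q² - p²)` gives the standard Beta integral. This is the
kernel of a composition of two unweighted fractional integrals. -/
theorem lintegral_beta_sq {α β p q : ℝ} (hα : 0 < α) (hβ : 0 < β) (hp : 0 ≤ p) (hpq : p < q) :
    ∫⁻ x in Ioo p q, ENNReal.ofReal ((x ^ 2 - p ^ 2) ^ (α - 1) * (q ^ 2 - x ^ 2) ^ (β - 1) * x) =
      ENNReal.ofReal (beta α β * ((q ^ 2 - p ^ 2) ^ (α + β - 1) / 2)) := by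
  have hd : 0 < q ^ 2 - p ^ 2 := by nlinarith
  set d := q ^ 2 - p ^ 2 with hd'
  have hmono : StrictMonoOn (fun x : ℝ => (x ^ 2 - p ^ 2) / d) (Icc p q) := by
    intro x hx y hy hxy
    have : x ^ 2 < y ^ 2 := by nlinarith [hx.1, hy.1]
    simp only
    gcongr
  have himg := image_Ioo_of_strictMonoOn hpq hmono (by fun_prop)
  simp only [sub_self, zero_div, ← hd', div_self hd.ne'] at himg
  refine lintegral_beta_subst hα hβ (u := fun x => (x ^ 2 - p ^ 2) / d) (u' := fun x => 2 * x / d)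
    (fun x _ => ?_) (fun x hx => ?_) (hmono.mono Ioo_subset_Icc_self).injOn himg (by positivity)
    fun x hx => ?_
  · have := (((hasDerivAt_id x).pow 2).sub_const (p ^ 2)).div_const d
    simpa using this
  · have : 0 ≤ x := hp.trans hx.1.le
    positivity
  · have h1 : 0 < x ^ 2 - p ^ 2 := by nlinarith [hx.1]
    have h2 : 0 < q ^ 2 - x ^ 2 := by nlinarith [hx.1, hx.2]
    have h3 : 1 - (x ^ 2 - p ^ 2) / d = (q ^ 2 - x ^ 2) / d := by
      field_simp; rw [hd']; ring
    have h4 : d ^ (α + β - 1) = d ^ (α - 1) * d ^ (β - 1) * d := by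
      rw [← Real.rpow_add hd, ← Real.rpow_add_one hd.ne']; ring_nf
    rw [h3, Real.div_rpow h1.le hd.le, Real.div_rpow h2.le hd.le, h4]
    have := Real.rpow_pos_of_pos hd (α - 1)
    have := Real.rpow_pos_of_pos hd (β - 1)
    field_simp

/-- The exponent `-2 (α + β)` is the one for which the inversion `x ↦ 1/x` reduces the integral to
the unweighted one: the normalised variable is affine in `1/x²`. -/
theorem lintegral_beta_sq_weighted {α β p q : ℝ} (hα : 0 < α) (hβ : 0 < β) (hp : 0 < p)
    (hpq : p < q) :
    ∫⁻ x in Ioo p q, ENNReal.ofReal ((x ^ 2 - p ^ 2) ^ (α - 1) * (q ^ 2 - x ^ 2) ^ (β - 1) *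
        (x ^ (-2 * (α + β)) * x)) =
      ENNReal.ofReal (beta α β *
        ((q ^ 2 - p ^ 2) ^ (α + β - 1) / 2 * (p ^ (-2 * β) * q ^ (-2 * α)))) := by
  have hq : 0 < q := hp.trans hpq
  have hd : 0 < q ^ 2 - p ^ 2 := by nlinarith
  set d := q ^ 2 - p ^ 2 with hd'
  set u : ℝ → ℝ := fun x => q ^ 2 / d * (1 - p ^ 2 / x ^ 2) with hu
  have hmono : StrictMonoOn u (Icc p q) := by
    intro x hx y hy hxy
    have hx0 : 0 < x := hp.trans_le hx.1
    have : x ^ 2 < y ^ 2 := by nlinarith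
    simp only [hu]
    gcongr
  have hcont : ContinuousOn u (Icc p q) := by
    refine continuousOn_const.mul (continuousOn_const.sub (continuousOn_const.div (by fun_prop) ?_))
    intro x hx
    have hx0 : 0 < x := hp.trans_le hx.1
    positivity
  have himg := image_Ioo_of_strictMonoOn hpq hmono hcont
  have hup : u p = 0 := by simp [hu, div_self, hp.ne']
  have huq : u q = 1 := by
    simp only [hu]; field_simp; exact hd'.symm
  rw [hup, huq] at himg
  refine lintegral_beta_subst hα hβ (u := u) (u' := fun x => q ^ 2 / d * (2 * p ^ 2 / x ^ 3))
    (fun x hx => ?_) (fun x hx => ?_) (hmono.mono Ioo_subset_Icc_self).injOn himg (by positivity)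
    fun x hx => ?_
  · have hx0 : 0 < x := hp.trans hx.1
    have := ((((hasDerivAt_id x).pow 2).inv (by simp [hx0.ne'])).const_mul (p ^ 2)).const_sub 1
      |>.const_mul (q ^ 2 / d)
    refine this.congr_deriv ?_ |>.congr_of_eventuallyEq (Filter.Eventually.of_forall fun y => ?_)
    · simp
      field_simp
    · simp [hu, div_eq_mul_inv]
  · have hx0 : 0 < x := hp.trans hx.1
    positivity
  · have hx0 : 0 < x := hp.trans hx.1
    have h1 : 0 < x ^ 2 - p ^ 2 := by nlinarith [hx.1]
    have h2 : 0 < q ^ 2 - x ^ 2 := by nlinarith [hx.1, hx.2]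
    have h3 : u x = (q ^ 2 * (x ^ 2 - p ^ 2)) / (d * x ^ 2) := by
      simp only [hu]; field_simp
    have h3' : 1 - (q ^ 2 * (x ^ 2 - p ^ 2)) / (d * x ^ 2) =
        (p ^ 2 * (q ^ 2 - x ^ 2)) / (d * x ^ 2) := by
      field_simp; rw [hd']; ring
    have h4 : d ^ (α + β - 1) = d ^ (α - 1) * d ^ (β - 1) * d := by
      rw [← Real.rpow_add hd, ← Real.rpow_add_one hd.ne']; ring_nf
    have e : ∀ (y s : ℝ), 0 < y → (y ^ 2) ^ (s - 1) = y ^ (2 * s) * (y ^ 2)⁻¹ := by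
      intro y s hy
      rw [← Real.rpow_natCast y 2, ← Real.rpow_mul hy.le, ← Real.rpow_neg hy.le,
        ← Real.rpow_add hy]
      push_cast; ring_nf
    have hn : ∀ (y s : ℝ), 0 < y → y ^ (-2 * s) = (y ^ (2 * s))⁻¹ := by
      intro y s hy
      rw [← Real.rpow_neg hy.le]; ring_nf
    rw [h3, h3', Real.div_rpow (by positivity) (by positivity),
      Real.div_rpow (by positivity) (by positivity), Real.mul_rpow (by positivity) h1.le,
      Real.mul_rpow (by positivity) h2.le, Real.mul_rpow hd.le (by positivity),
      Real.mul_rpow hd.le (by positivity), e q α hq, e p β hp, e x α hx0, e x β hx0, h4, hn p β hp,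
      hn q α hq, hn x _ hx0, mul_add, Real.rpow_add hx0]
    have := Real.rpow_pos_of_pos hd (α - 1)
    have := Real.rpow_pos_of_pos hd (β - 1)
    have := Real.rpow_pos_of_pos hx0 (2 * α)
    have := Real.rpow_pos_of_pos hx0 (2 * β)
    have := Real.rpow_pos_of_pos hq (2 * α)
    have := Real.rpow_pos_of_pos hp (2 * β)
    field_simp

/-! ### Fubini's theorem for integral operators with nonnegative kernels -/

/-- Tonelli: the mass of `K` in its first variable is at most `κ`, so integrability of `κ g`
controls the double integral. -/
theorem integrable_kernel_prod {μ ν : Measure ℝ} [SFinite μ] [SFinite ν] {K : ℝ → ℝ → ℝ}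
    {κ : ℝ → ℝ} {g : ℝ → ℂ} (hK : Measurable (Function.uncurry K)) (hK0 : ∀ x r, 0 ≤ K x r)
    (hκ : ∀ᵐ r ∂ν, ∫⁻ x, ENNReal.ofReal (K x r) ∂μ ≤ ENNReal.ofReal (κ r))
    (hκ0 : ∀ᵐ r ∂ν, 0 ≤ κ r) (hg : AEStronglyMeasurable g ν)
    (hint : Integrable (fun r => κ r • g r) ν) :
    Integrable (fun p : ℝ × ℝ => K p.1 p.2 • g p.2) (μ.prod ν) := by
  have hKm : AEStronglyMeasurable (fun p : ℝ × ℝ => K p.1 p.2) (μ.prod ν) :=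
    hK.aestronglyMeasurable
  have hm : AEStronglyMeasurable (fun p : ℝ × ℝ => K p.1 p.2 • g p.2) (μ.prod ν) :=
    hKm.smul hg.comp_snd
  have hint' : ∀ᵐ r ∂ν, Integrable (fun x => K x r) μ ∧ ∫ x, K x r ∂μ ≤ κ r := by
    filter_upwards [hκ, hκ0] with r hr hr0
    have hmr : Measurable fun x => K x r := hK.comp (measurable_id.prodMk measurable_const)
    have hfin : ∫⁻ x, ENNReal.ofReal (K x r) ∂μ ≠ ⊤ := (hr.trans_lt ENNReal.ofReal_lt_top).ne
    refine ⟨⟨hmr.aestronglyMeasurable, ?_⟩, ?_⟩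
    · rw [hasFiniteIntegral_iff_ofReal (Filter.Eventually.of_forall fun x => hK0 x r)]
      exact lt_top_iff_ne_top.2 hfin
    · rw [integral_eq_lintegral_of_nonneg_ae (Filter.Eventually.of_forall fun x => hK0 x r)
        hmr.aestronglyMeasurable]
      exact (ENNReal.toReal_mono ENNReal.ofReal_ne_top hr).trans_eq (ENNReal.toReal_ofReal hr0)
  rw [integrable_prod_iff' hm]
  refine ⟨hint'.mono fun r hr => Integrable.smul_const (f := fun x => K x r) hr.1 (g r),
    hint.norm.mono' hm.norm.prod_swap.integral_prod_right' ?_⟩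
  filter_upwards [hint', hκ0] with r hr hr0
  simp_rw [norm_smul, integral_mul_const]
  rw [norm_mul, norm_norm, Real.norm_of_nonneg (integral_nonneg fun x => norm_nonneg _),
    Real.norm_of_nonneg hr0]
  gcongr
  simpa [abs_of_nonneg (hK0 _ _)] using hr.2

theorem integral_kernel_swap {μ ν : Measure ℝ} [SFinite μ] [SFinite ν] {K : ℝ → ℝ → ℝ}
    {κ : ℝ → ℝ} {g : ℝ → ℂ} (hK : Measurable (Function.uncurry K)) (hK0 : ∀ x r, 0 ≤ K x r)
    (hκ : ∀ᵐ r ∂ν, ∫⁻ x, ENNReal.ofReal (K x r) ∂μ = ENNReal.ofReal (κ r))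
    (hκ0 : ∀ᵐ r ∂ν, 0 ≤ κ r) (hg : AEStronglyMeasurable g ν)
    (hint : Integrable (fun r => κ r • g r) ν) :
    ∫ x, ∫ r, K x r • g r ∂ν ∂μ = ∫ r, κ r • g r ∂ν := by
  rw [integral_integral_swap
    (integrable_kernel_prod hK hK0 (hκ.mono fun r hr => hr.le) hκ0 hg hint)]
  refine integral_congr_ae ?_
  filter_upwards [hκ, hκ0] with r hr hr0
  have hmr : Measurable fun x => K x r := hK.comp (measurable_id.prodMk measurable_const)
  rw [integral_smul_const, integral_eq_lintegral_of_nonneg_ae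
    (Filter.Eventually.of_forall fun x => hK0 x r) hmr.aestronglyMeasurable, hr,
    ENNReal.toReal_ofReal hr0]

/-! ### Composition of Erdélyi–Kober integrals -/

/-- Dividing by the weight recovers measurability of a function known only through a weighted
integrability condition, as is the case for `f₀`. -/
theorem aestronglyMeasurable_of_smul {w : ℝ → ℝ} {g : ℝ → ℂ} {s : Set ℝ} (hs : MeasurableSet s)
    (hw : Measurable w) (hw0 : ∀ r ∈ s, w r ≠ 0)
    (h : AEStronglyMeasurable (fun r => w r • g r) (volume.restrict s)) :
    AEStronglyMeasurable g (volume.restrict s) := by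
  refine AEStronglyMeasurable.congr (f := fun r => (w r)⁻¹ • w r • g r)
    (hw.inv.aestronglyMeasurable.smul h) ?_
  filter_upwards [ae_restrict_mem hs] with r hr
  rw [inv_smul_smul₀ (hw0 r hr)]

theorem integrableOn_of_const_smul {c : ℝ} (hc : c ≠ 0) {f : ℝ → ℂ} {s : Set ℝ}
    (h : IntegrableOn (fun x => c • f x) s) : IntegrableOn f s :=
  (integrable_smul_iff hc f).1 h

theorem beta_const_mul {α β : ℝ} (hα : 0 < α) (hβ : 0 < β) :
    2 / Real.Gamma β * (2 / Real.Gamma α) * (beta α β / 2) = 2 / Real.Gamma (α + β) := by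
  have h1 := Real.Gamma_pos_of_pos hα
  have h2 := Real.Gamma_pos_of_pos hβ
  have h3 := Real.Gamma_pos_of_pos (add_pos hα hβ)
  rw [beta]
  field_simp

/-- The role of `1 ≤ α + β` is that the composed kernel is bounded on `(0, t]` by a multiple of `r`.
Integrability of `r φ` therefore gives convergence of the outer integral at every `t`, although the
inner one converges only almost everywhere. -/
theorem ekPlus_comp {α β t : ℝ} {φ : ℝ → ℂ} (hα : 0 < α) (hβ : 0 < β) (hαβ : 1 ≤ α + β)
    (ht : 0 < t) (hφ : IntegrableOn (fun r => r • φ r) (Ioc 0 t)) :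
    (∀ᵐ x ∂(volume.restrict (Ioc 0 t)), EKPlusExists α φ x) ∧
    EKPlusExists β (ekPlus α φ) t ∧ ekPlus β (ekPlus α φ) t = ekPlus (α + β) φ t := by
  have hB := beta_pos hα hβ
  have hφm : AEStronglyMeasurable φ (volume.restrict (Ioc 0 t)) :=
    aestronglyMeasurable_of_smul measurableSet_Ioc measurable_id (fun r hr => hr.1.ne')
      hφ.aestronglyMeasurable
  set c : ℝ → ℝ := fun x => (t ^ 2 - x ^ 2) ^ (β - 1) * x with hc
  -- The joint kernel is extended by zero off the triangle, so that Fubini applies on a product.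
  set K : ℝ → ℝ → ℝ := fun x r => if 0 < r ∧ r ≤ x ∧ x ≤ t then
    c x * ((x ^ 2 - r ^ 2) ^ (α - 1) * r) else 0 with hK
  set κ : ℝ → ℝ := fun r => beta α β * ((t ^ 2 - r ^ 2) ^ (α + β - 1) / 2) * r with hκ
  have hKm : Measurable (Function.uncurry K) := by
    refine Measurable.ite ?_ (by simp only [hc]; fun_prop) measurable_const
    exact ((measurableSet_lt measurable_const measurable_snd).inter
      ((measurableSet_le measurable_snd measurable_fst).inter
        (measurableSet_le measurable_fst measurable_const)))
  have hK0 : ∀ x r, 0 ≤ K x r := by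
    intro x r
    simp only [hK, hc]
    split_ifs with h
    · have h1 : 0 ≤ x := h.1.le.trans h.2.1
      have h2 : 0 ≤ t ^ 2 - x ^ 2 := by nlinarith [h.2.2]
      have h3 : 0 ≤ x ^ 2 - r ^ 2 := by nlinarith [h.2.1, h.1]
      have := h.1
      positivity
    · exact le_rfl
  have hκ0 : ∀ᵐ r ∂(volume.restrict (Ioc 0 t)), 0 ≤ κ r := by
    filter_upwards [ae_restrict_mem measurableSet_Ioc] with r hr
    have h2 : 0 ≤ t ^ 2 - r ^ 2 := by nlinarith [hr.1, hr.2]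
    have := hr.1
    positivity
  have hker : ∀ᵐ r ∂(volume.restrict (Ioc 0 t)),
      ∫⁻ x in Ioc 0 t, ENNReal.ofReal (K x r) = ENNReal.ofReal (κ r) := by
    filter_upwards [ae_restrict_mem measurableSet_Ioc,
      ae_restrict_of_ae (compl_mem_ae_iff.2 (measure_singleton t))] with r hr hrt
    have hrt' : r < t := lt_of_le_of_ne hr.2 hrt
    calc ∫⁻ x in Ioc 0 t, ENNReal.ofReal (K x r)
        = ∫⁻ x in Ioc 0 t, (Icc r t).indicator (fun x => ENNReal.ofReal
          (r * ((x ^ 2 - r ^ 2) ^ (α - 1) * (t ^ 2 - x ^ 2) ^ (β - 1) * x))) x := by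
          refine lintegral_congr fun x => ?_
          by_cases hx : x ∈ Icc r t
          · rw [indicator_of_mem hx]
            simp only [hK, hc, if_pos (show 0 < r ∧ r ≤ x ∧ x ≤ t from ⟨hr.1, hx.1, hx.2⟩)]
            ring_nf
          · rw [indicator_of_notMem hx]
            simp only [hK]
            rw [if_neg (fun h => hx h.2), ENNReal.ofReal_zero]
      _ = ENNReal.ofReal r * ∫⁻ x in Ioo r t, ENNReal.ofReal
            ((x ^ 2 - r ^ 2) ^ (α - 1) * (t ^ 2 - x ^ 2) ^ (β - 1) * x) := by
          rw [setLIntegral_indicator measurableSet_Icc,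
            inter_eq_left.2 (show Icc r t ⊆ Ioc 0 t from fun x hx => ⟨hr.1.trans_le hx.1, hx.2⟩),
            setLIntegral_congr Ioo_ae_eq_Icc.symm, ← lintegral_const_mul' _ _ ENNReal.ofReal_ne_top]
          simp_rw [ENNReal.ofReal_mul hr.1.le]
      _ = _ := by
          rw [lintegral_beta_sq hα hβ hr.1.le hrt', ← ENNReal.ofReal_mul hr.1.le, hκ]
          ring_nf
  have hint : IntegrableOn (fun r => κ r • φ r) (Ioc 0 t) := by
    have : IntegrableOn (fun r => (beta α β * ((t ^ 2 - r ^ 2) ^ (α + β - 1) / 2)) • (r • φ r))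
        (Ioc 0 t) := by
      refine Integrable.bdd_smul (φ := fun r => beta α β * ((t ^ 2 - r ^ 2) ^ (α + β - 1) / 2))
        hφ (beta α β * ((t ^ 2) ^ (α + β - 1) / 2)) ?_ ?_
      · exact Measurable.aestronglyMeasurable (by fun_prop)
      · filter_upwards [ae_restrict_mem measurableSet_Ioc] with r hr
        have h2 : 0 ≤ t ^ 2 - r ^ 2 := by nlinarith [hr.1, hr.2]
        rw [Real.norm_of_nonneg (by positivity)]
        gcongr
        nlinarith
    simpa only [hκ, mul_smul] using this
  have hslice : ∀ x ∈ Ioc 0 t, ∀ r, r ∈ Ioc 0 t → K x r • φ r =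
      (Ioc 0 x).indicator (fun r => c x • (((x ^ 2 - r ^ 2) ^ (α - 1) * r) • φ r)) r := by
    intro x hx r hr
    by_cases hrx : r ≤ x
    · rw [indicator_of_mem (show r ∈ Ioc 0 x from ⟨hr.1, hrx⟩)]
      simp only [hK]
      rw [if_pos ⟨hr.1, hrx, hx.2⟩, mul_smul]
    · rw [indicator_of_notMem (fun h => hrx h.2)]
      simp only [hK]
      rw [if_neg (fun h => hrx h.2.1), zero_smul]
  have hprod := integrable_kernel_prod hKm hK0 (hker.mono fun r hr => hr.le) hκ0 hφm hint
  have hGα := Real.Gamma_pos_of_pos hα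
  have hin : ∀ x ∈ Ioc 0 t, ∫ r in Ioc 0 t, K x r • φ r =
      (Real.Gamma α / 2) • (c x • ekPlus α φ x) := by
    intro x hx
    rw [setIntegral_congr_fun measurableSet_Ioc (hslice x hx), setIntegral_indicator measurableSet_Ioc,
      inter_eq_right.2 (Ioc_subset_Ioc_right hx.2), integral_smul, ekPlus, smul_comm (c x), smul_smul]
    rw [div_mul_div_cancel₀ two_ne_zero, div_self hGα.ne', one_smul]
  refine ⟨?_, ?_, ?_⟩
  · filter_upwards [hprod.prod_right_ae, ae_restrict_mem measurableSet_Ioc,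
      ae_restrict_of_ae (compl_mem_ae_iff.2 (measure_singleton t))] with x hx hxt hxt'
    have hxlt : x < t := lt_of_le_of_ne hxt.2 hxt'
    have h1 : IntegrableOn ((Ioc 0 x).indicator
        (fun r => c x • (((x ^ 2 - r ^ 2) ^ (α - 1) * r) • φ r))) (Ioc 0 t) :=
      IntegrableOn.congr_fun hx (hslice x hxt) measurableSet_Ioc
    rw [IntegrableOn, integrable_indicator_iff measurableSet_Ioc, IntegrableOn,
      Measure.restrict_restrict measurableSet_Ioc,
      inter_eq_left.2 (Ioc_subset_Ioc_right hxt.2)] at h1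
    -- The outer weight may vanish at `x = t`; that point was discarded so that the weight can be
    -- divided out.
    have hcx : c x ≠ 0 := by
      have h2 : 0 < t ^ 2 - x ^ 2 := by nlinarith [hxt.1]
      have := hxt.1
      simp only [hc]
      positivity
    exact integrableOn_of_const_smul hcx h1
  · have h1 : IntegrableOn (fun x => (Real.Gamma α / 2) • (c x • ekPlus α φ x)) (Ioc 0 t) :=
      IntegrableOn.congr_fun hprod.integral_prod_left hin measurableSet_Ioc
    exact integrableOn_of_const_smul (by positivity) h1
  · have h1 := integral_kernel_swap hKm hK0 hker hκ0 hφm hint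
    rw [setIntegral_congr_fun measurableSet_Ioc hin, integral_smul] at h1
    have h2 : ∫ r in Ioc 0 t, c r • ekPlus α φ r =
        (2 / Real.Gamma α) • ∫ r in Ioc 0 t, κ r • φ r := by
      rw [← h1, smul_smul, div_mul_div_cancel₀ hGα.ne', div_self two_ne_zero, one_smul]
    have h3 : ∀ r, κ r • φ r =
        (beta α β / 2) • (((t ^ 2 - r ^ 2) ^ (α + β - 1) * r) • φ r) := by
      intro r
      rw [smul_smul, hκ]
      ring_nf
    rw [ekPlus, h2, ekPlus, ← beta_const_mul hα hβ]
    simp_rw [h3]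
    rw [integral_smul, smul_smul, smul_smul]

/-- The intermediate weight `w` is left free because the composition is needed both with `w = 1` and
with the power that belongs to odd `k`; only the Beta integral `κ` depends on it. -/
theorem ekMinus_comp {α β t : ℝ} {w κ : ℝ → ℝ} {g : ℝ → ℂ} (hα : 0 < α) (ht : 0 ≤ t)
    (hwm : Measurable w) (hw : ∀ x, t < x → 0 < w x)
    (hκ : ∀ r, t < r → ∫⁻ x in Ioo t r, ENNReal.ofReal
      ((x ^ 2 - t ^ 2) ^ (β - 1) * (r ^ 2 - x ^ 2) ^ (α - 1) * (w x * x)) = ENNReal.ofReal (κ r))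
    (hκ0 : ∀ r, t < r → 0 ≤ κ r) (hg : AEStronglyMeasurable g (volume.restrict (Ioi t)))
    (hint : IntegrableOn (fun r => (κ r * r) • g r) (Ioi t)) :
    (∀ᵐ x ∂(volume.restrict (Ioi t)), EKMinusExists α g x) ∧
    EKMinusExists β (fun x => w x • ekMinus α g x) t ∧
    ekMinus β (fun x => w x • ekMinus α g x) t =
      (2 / Real.Gamma β * (2 / Real.Gamma α)) • ∫ r in Ioi t, (κ r * r) • g r := by
  set c : ℝ → ℝ := fun x => (x ^ 2 - t ^ 2) ^ (β - 1) * (w x * x) with hc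
  set K : ℝ → ℝ → ℝ := fun x r => if t < x ∧ x < r then
    c x * ((r ^ 2 - x ^ 2) ^ (α - 1) * r) else 0 with hK
  have hKm : Measurable (Function.uncurry K) := by
    refine Measurable.ite ?_ (by simp only [hc]; fun_prop) measurable_const
    exact ((measurableSet_lt measurable_const measurable_fst).inter
      (measurableSet_lt measurable_fst measurable_snd))
  have hcpos : ∀ x, t < x → 0 < c x := by
    intro x hx
    have h1 : 0 < x := ht.trans_lt hx
    have h2 : 0 < x ^ 2 - t ^ 2 := by nlinarith
    have := hw x hx
    simp only [hc]
    positivity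
  have hK0 : ∀ x r, 0 ≤ K x r := by
    intro x r
    simp only [hK]
    split_ifs with h
    · have h1 : 0 < x := ht.trans_lt h.1
      have h3 : 0 ≤ r ^ 2 - x ^ 2 := by nlinarith [h.2]
      have := hcpos x h.1
      have := h1.trans h.2
      positivity
    · exact le_rfl
  have hκ0' : ∀ᵐ r ∂(volume.restrict (Ioi t)), 0 ≤ κ r * r := by
    filter_upwards [ae_restrict_mem measurableSet_Ioi] with r hr
    exact mul_nonneg (hκ0 r hr) (ht.trans (le_of_lt hr))
  have hker : ∀ᵐ r ∂(volume.restrict (Ioi t)),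
      ∫⁻ x in Ioi t, ENNReal.ofReal (K x r) = ENNReal.ofReal (κ r * r) := by
    filter_upwards [ae_restrict_mem measurableSet_Ioi] with r hr
    have hr0 : 0 ≤ r := ht.trans (le_of_lt hr)
    calc ∫⁻ x in Ioi t, ENNReal.ofReal (K x r)
        = ∫⁻ x in Ioi t, (Ioo t r).indicator (fun x => ENNReal.ofReal
          (r * ((x ^ 2 - t ^ 2) ^ (β - 1) * (r ^ 2 - x ^ 2) ^ (α - 1) * (w x * x)))) x := by
          refine lintegral_congr fun x => ?_
          by_cases hx : x ∈ Ioo t r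
          · rw [indicator_of_mem hx]
            simp only [hK, hc, if_pos (show t < x ∧ x < r from hx)]
            ring_nf
          · rw [indicator_of_notMem hx]
            simp only [hK]
            rw [if_neg (show ¬ (t < x ∧ x < r) from hx), ENNReal.ofReal_zero]
      _ = ENNReal.ofReal r * ∫⁻ x in Ioo t r, ENNReal.ofReal
            ((x ^ 2 - t ^ 2) ^ (β - 1) * (r ^ 2 - x ^ 2) ^ (α - 1) * (w x * x)) := by
          rw [setLIntegral_indicator measurableSet_Ioo, inter_eq_left.2 Ioo_subset_Ioi_self,
            ← lintegral_const_mul' _ _ ENNReal.ofReal_ne_top]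
          simp_rw [ENNReal.ofReal_mul hr0]
      _ = _ := by
          rw [hκ r hr, ← ENNReal.ofReal_mul hr0, mul_comm]
  have hslice : ∀ x ∈ Ioi t, ∀ r, r ∈ Ioi t → K x r • g r =
      (Ioi x).indicator (fun r => c x • (((r ^ 2 - x ^ 2) ^ (α - 1) * r) • g r)) r := by
    intro x hx r hr
    by_cases hrx : x < r
    · rw [indicator_of_mem (show r ∈ Ioi x from hrx)]
      simp only [hK]
      rw [if_pos ⟨hx, hrx⟩, mul_smul]
    · rw [indicator_of_notMem (show r ∉ Ioi x from hrx)]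
      simp only [hK]
      rw [if_neg (fun h => hrx h.2), zero_smul]
  have hprod := integrable_kernel_prod hKm hK0 (hker.mono fun r hr => hr.le) hκ0' hg hint
  have hGα := Real.Gamma_pos_of_pos hα
  have hin : ∀ x ∈ Ioi t, ∫ r in Ioi t, K x r • g r =
      (Real.Gamma α / 2) • (((x ^ 2 - t ^ 2) ^ (β - 1) * x) • (w x • ekMinus α g x)) := by
    intro x hx
    rw [setIntegral_congr_fun measurableSet_Ioi (hslice x hx), setIntegral_indicator measurableSet_Ioi,
      inter_eq_right.2 (Ioi_subset_Ioi (le_of_lt hx)), integral_smul, ekMinus, smul_smul _ (w x),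
      show (x ^ 2 - t ^ 2) ^ (β - 1) * x * w x = c x by simp only [hc]; ring, smul_comm (c x), smul_smul]
    rw [div_mul_div_cancel₀ two_ne_zero, div_self hGα.ne', one_smul]
  refine ⟨?_, ?_, ?_⟩
  · filter_upwards [hprod.prod_right_ae, ae_restrict_mem measurableSet_Ioi] with x hx hxt
    have h1 : IntegrableOn ((Ioi x).indicator
        (fun r => c x • (((r ^ 2 - x ^ 2) ^ (α - 1) * r) • g r))) (Ioi t) :=
      IntegrableOn.congr_fun hx (hslice x hxt) measurableSet_Ioi
    rw [IntegrableOn, integrable_indicator_iff measurableSet_Ioi, IntegrableOn,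
      Measure.restrict_restrict measurableSet_Ioi,
      inter_eq_left.2 (Ioi_subset_Ioi (le_of_lt hxt))] at h1
    exact integrableOn_of_const_smul (hcpos x hxt).ne' h1
  · have h1 := IntegrableOn.congr_fun hprod.integral_prod_left hin measurableSet_Ioi
    exact integrableOn_of_const_smul (by positivity) h1
  · have h1 := integral_kernel_swap hKm hK0 hker hκ0' hg hint
    rw [setIntegral_congr_fun measurableSet_Ioi hin, integral_smul] at h1
    rw [ekMinus, ← h1, smul_smul, mul_assoc, div_mul_div_cancel₀ hGα.ne', div_self two_ne_zero,
      mul_one]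

theorem ekMinus_ekMinus {α β t : ℝ} {g : ℝ → ℂ} (hα : 0 < α) (hβ : 0 < β) (ht : 0 ≤ t)
    (hg : AEStronglyMeasurable g (volume.restrict (Ioi t)))
    (hint : EKMinusExists (α + β) g t) :
    (∀ᵐ x ∂(volume.restrict (Ioi t)), EKMinusExists α g x) ∧
    EKMinusExists β (ekMinus α g) t ∧ ekMinus β (ekMinus α g) t = ekMinus (α + β) g t := by
  have hB := beta_pos hβ hα
  have h3 : ∀ r, (beta β α * ((r ^ 2 - t ^ 2) ^ (β + α - 1) / 2) * r) • g r =
      (beta β α / 2) • (((r ^ 2 - t ^ 2) ^ (α + β - 1) * r) • g r) := by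
    intro r
    rw [smul_smul]
    ring_nf
  have h := ekMinus_comp (β := β) (w := fun _ => 1) (g := g)
    (κ := fun r => beta β α * ((r ^ 2 - t ^ 2) ^ (β + α - 1) / 2)) hα ht measurable_const
    (fun _ _ => one_pos)
    (fun r hr => by simpa only [one_mul] using lintegral_beta_sq hβ hα ht hr)
    (fun r hr => by
      have : 0 ≤ r ^ 2 - t ^ 2 := by nlinarith
      positivity) hg (by simp only [h3]; exact hint.smul (beta β α / 2))
  simp only [one_smul, h3] at h
  refine ⟨h.1, h.2.1, ?_⟩
  rw [h.2.2, integral_smul, smul_smul, ekMinus, mul_comm (2 / Real.Gamma β), beta_const_mul hβ hα,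
    add_comm β]

/-- With `β = 1/2` the weighted Beta integral leaves the factor `t^{-2α} r^{-1}`: the first part is
removed by `t^{2α}`, the second moves onto `g` and lowers the decay required at infinity by one
power. For `α = k/2` this explains the powers in `𝒟^{k/2}_{-,2}` for odd `k`. -/
theorem ekMinus_half_weighted {α t : ℝ} {g : ℝ → ℂ} (hα : 0 < α) (ht : 0 < t)
    (hg : AEStronglyMeasurable g (volume.restrict (Ioi t)))
    (hint : EKMinusExists (α + 1 / 2) (fun r => r⁻¹ • g r) t) :
    EKMinusExists (1 / 2) (fun x => x ^ (-2 * (α + 1 / 2)) • ekMinus α g x) t ∧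
    t ^ (2 * α) • ekMinus (1 / 2) (fun x => x ^ (-2 * (α + 1 / 2)) • ekMinus α g x) t =
      ekMinus (α + 1 / 2) (fun r => r⁻¹ • g r) t := by
  have hβ : (0 : ℝ) < 1 / 2 := by norm_num
  have hB := beta_pos hβ hα
  have h3 : ∀ r ∈ Ioi t, (beta (1 / 2) α * ((r ^ 2 - t ^ 2) ^ (1 / 2 + α - 1) / 2 *
      (t ^ (-2 * α) * r ^ (-2 * (1 / 2 : ℝ)))) * r) • g r =
      (beta (1 / 2) α / 2 * t ^ (-2 * α)) •
        (((r ^ 2 - t ^ 2) ^ (α + 1 / 2 - 1) * r) • (r⁻¹ • g r)) := by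
    intro r hr
    have hr0 : 0 < r := ht.trans hr
    rw [smul_smul, smul_smul, show (-2 * (1 / 2 : ℝ)) = -1 by norm_num, Real.rpow_neg_one]
    ring_nf
  have h := ekMinus_comp (β := 1 / 2) (w := fun x => x ^ (-2 * (α + 1 / 2))) (g := g)
    (κ := fun r => beta (1 / 2) α * ((r ^ 2 - t ^ 2) ^ (1 / 2 + α - 1) / 2 *
      (t ^ (-2 * α) * r ^ (-2 * (1 / 2 : ℝ))))) hα ht.le (by fun_prop)
    (fun x hx => Real.rpow_pos_of_pos (ht.trans hx) _)
    (fun r hr => by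
      rw [add_comm α]
      exact lintegral_beta_sq_weighted hβ hα ht hr)
    (fun r hr => by
      have : 0 ≤ r ^ 2 - t ^ 2 := by nlinarith
      have := ht.trans hr
      positivity) hg
    (by
      refine IntegrableOn.congr_fun (hint.smul (beta (1 / 2) α / 2 * t ^ (-2 * α)))
        (fun r hr => (h3 r hr).symm) measurableSet_Ioi)
  refine ⟨h.2.1, ?_⟩
  rw [h.2.2, setIntegral_congr_fun measurableSet_Ioi h3, integral_smul, smul_smul, smul_smul, ekMinus,
    add_comm α, ← beta_const_mul hβ hα]
  congr 1
  rw [show (-2 * α) = -(2 * α) by ring, Real.rpow_neg ht.le]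
  have := Real.rpow_pos_of_pos ht (2 * α)
  field_simp

/-! ### Differentiation of indefinite integrals -/

section Primitive

variable {h : ℝ → ℂ} {a b : ℝ}

theorem hasDerivAt_setIntegral_Ioc (hh : IntegrableOn h (Ioc a b)) {t : ℝ} (ht : t ∈ Ioo a b)
    (hc : ContinuousAt h t) : HasDerivAt (fun x => ∫ r in Ioc a x, h r) (h t) t := by
  have h1 : IntervalIntegrable h volume a t :=
    (intervalIntegrable_iff_integrableOn_Ioc_of_le ht.1.le).2
      (hh.mono_set (Ioc_subset_Ioc_right ht.2.le))
  have h2 := intervalIntegral.integral_hasDerivAt_right h1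
    ⟨Ioc a b, Ioc_mem_nhds ht.1 ht.2, hh.aestronglyMeasurable⟩ hc
  refine h2.congr_of_eventuallyEq ?_
  filter_upwards [Ioi_mem_nhds ht.1] with x hx
  rw [intervalIntegral.integral_of_le (le_of_lt hx)]

theorem ae_hasDerivAt_setIntegral_Ioc (hab : a ≤ b) (hh : IntegrableOn h (Ioc a b)) :
    ∀ᵐ t, t ∈ Ioo a b → HasDerivAt (fun x => ∫ r in Ioc a x, h r) (h t) t := by
  have h1 : IntervalIntegrable h volume a b :=
    (intervalIntegrable_iff_integrableOn_Ioc_of_le hab).2 hh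
  filter_upwards [h1.ae_hasDerivAt_integral] with t ht hmem
  refine (ht (by rw [uIcc_of_le hab]; exact Ioo_subset_Icc_self hmem) a
    left_mem_uIcc).congr_of_eventuallyEq ?_
  filter_upwards [Ioi_mem_nhds hmem.1] with x hx
  rw [intervalIntegral.integral_of_le (le_of_lt hx)]

theorem continuousOn_setIntegral_Ioc (hh : IntegrableOn h (Ioc a b)) :
    ContinuousOn (fun x => ∫ r in Ioc a x, h r) (Ioo a b) := by
  refine (intervalIntegral.continuousOn_primitive ?_).mono Ioo_subset_Icc_self
  rwa [integrableOn_Icc_iff_integrableOn_Ioc]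

theorem ae_restrict_Ioi_of_forall_Ioo {p : ℝ → Prop}
    (hp : ∀ a b : ℝ, 0 < a → a < b → ∀ᵐ t, t ∈ Ioo a b → p t) :
    ∀ᵐ t ∂(volume.restrict (Ioi (0 : ℝ))), p t := by
  rw [ae_restrict_iff' measurableSet_Ioi]
  -- Countably many intervals exhaust `(0, ∞)`; the upper end `n + 2` makes even the one for `n = 0`
  -- nonempty.
  have h : ∀ᵐ t : ℝ, ∀ n : ℕ, t ∈ Ioo (1 / ((n : ℝ) + 1)) (n + 2) → p t := by
    refine ae_all_iff.2 fun n => hp _ _ (by positivity) ?_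
    have : 1 / ((n : ℝ) + 1) ≤ 1 := by
      rw [div_le_one (by positivity)]
      linarith [n.cast_nonneg (α := ℝ)]
    linarith [n.cast_nonneg (α := ℝ)]
  filter_upwards [h] with t ht ht0
  obtain ⟨n, hn⟩ := exists_nat_gt (max t (1 / t))
  have h1 : t < n := (le_max_left _ _).trans_lt hn
  have h2 : 1 / t < n := (le_max_right _ _).trans_lt hn
  refine ht n ⟨?_, by linarith⟩
  rw [div_lt_iff₀ (by positivity)]
  rw [div_lt_iff₀ ht0] at h2
  nlinarith [show (0 : ℝ) < t from ht0]

theorem setIntegral_Ioi_eq_sub (hh : IntegrableOn h (Ioi a)) {x : ℝ} (hx : a ≤ x) :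
    ∫ r in Ioi x, h r = (∫ r in Ioi a, h r) - ∫ r in Ioc a x, h r := by
  rw [← Ioc_union_Ioi_eq_Ioi hx, setIntegral_union Ioc_disjoint_Ioi_same measurableSet_Ioi
    (hh.mono_set Ioc_subset_Ioi_self) (hh.mono_set (Ioi_subset_Ioi hx)), add_sub_cancel_left]

theorem hasDerivAt_setIntegral_Ioi_of_Ioc (hh : IntegrableOn h (Ioi a)) {t : ℝ} (ht : a < t)
    (hd : HasDerivAt (fun x => ∫ r in Ioc a x, h r) (h t) t) :
    HasDerivAt (fun x => ∫ r in Ioi x, h r) (-h t) t := by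
  refine (hd.const_sub (∫ r in Ioi a, h r)).congr_of_eventuallyEq ?_
  filter_upwards [Ioi_mem_nhds ht] with x hx
  rw [setIntegral_Ioi_eq_sub hh (le_of_lt hx)]

end Primitive

/-! ### The operators of order one -/

theorem ekPlus_one (ψ : ℝ → ℂ) (t : ℝ) :
    ekPlus 1 ψ t = (2 : ℝ) • ∫ r in Ioc 0 t, r • ψ r := by
  simp [ekPlus]

theorem ekMinus_one (ψ : ℝ → ℂ) (t : ℝ) :
    ekMinus 1 ψ t = (2 : ℝ) • ∫ r in Ioi t, r • ψ r := by
  simp [ekMinus]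

theorem ekPlusExists_one {ψ : ℝ → ℂ} {t : ℝ} :
    EKPlusExists 1 ψ t ↔ IntegrableOn (fun r => r • ψ r) (Ioc 0 t) := by
  simp [EKPlusExists]

theorem ekMinusExists_one {ψ : ℝ → ℂ} {t : ℝ} :
    EKMinusExists 1 ψ t ↔ IntegrableOn (fun r => r • ψ r) (Ioi t) := by
  simp [EKMinusExists]

section OrderOne

variable {ψ : ℝ → ℂ}

theorem hasDerivAt_ekPlus_one (hψ : ∀ t, 0 < t → EKPlusExists 1 ψ t) {t : ℝ} (ht : 0 < t)
    (hc : ContinuousAt ψ t) : HasDerivAt (ekPlus 1 ψ) ((1 * 2 * t) • ψ t) t := by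
  have h1 := hasDerivAt_setIntegral_Ioc (ekPlusExists_one.1 (hψ (t + 1) (by linarith)))
    ⟨ht, by linarith⟩ (continuousAt_id.smul hc)
  rw [funext (ekPlus_one ψ), one_mul, mul_smul]
  exact h1.const_smul (2 : ℝ)

theorem ae_hasDerivAt_ekPlus_one (hψ : ∀ t, 0 < t → EKPlusExists 1 ψ t) :
    ∀ᵐ t ∂(volume.restrict (Ioi (0 : ℝ))), HasDerivAt (ekPlus 1 ψ) ((1 * 2 * t) • ψ t) t := by
  refine ae_restrict_Ioi_of_forall_Ioo fun a b ha hab => ?_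
  filter_upwards [ae_hasDerivAt_setIntegral_Ioc (ha.trans hab).le
    (ekPlusExists_one.1 (hψ b (ha.trans hab)))] with t ht hmem
  rw [funext (ekPlus_one ψ), one_mul, mul_smul]
  exact (ht ⟨ha.trans hmem.1, hmem.2⟩).const_smul (2 : ℝ)

theorem continuousAt_ekPlus_one (hψ : ∀ t, 0 < t → EKPlusExists 1 ψ t) {t : ℝ} (ht : 0 < t) :
    ContinuousAt (ekPlus 1 ψ) t := by
  rw [funext (ekPlus_one ψ)]
  exact ((continuousOn_setIntegral_Ioc (ekPlusExists_one.1 (hψ (t + 1) (by linarith)))).const_smul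
    (2 : ℝ)).continuousAt (Ioo_mem_nhds ht (by linarith))

theorem hasDerivAt_ekMinus_one (hψ : ∀ t, 0 < t → EKMinusExists 1 ψ t) {t : ℝ} (ht : 0 < t)
    (hc : ContinuousAt ψ t) : HasDerivAt (ekMinus 1 ψ) ((-1 * 2 * t) • ψ t) t := by
  have h0 := ekMinusExists_one.1 (hψ (t / 2) (by linarith))
  have h1 := hasDerivAt_setIntegral_Ioi_of_Ioc h0 (by linarith) <|
    hasDerivAt_setIntegral_Ioc (b := t + 1) (h0.mono_set Ioc_subset_Ioi_self)
      ⟨by linarith, by linarith⟩ (continuousAt_id.smul hc)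
  rw [funext (ekMinus_one ψ), neg_one_mul, neg_mul, neg_smul, mul_smul, ← smul_neg]
  exact h1.const_smul (2 : ℝ)

theorem ae_hasDerivAt_ekMinus_one (hψ : ∀ t, 0 < t → EKMinusExists 1 ψ t) :
    ∀ᵐ t ∂(volume.restrict (Ioi (0 : ℝ))), HasDerivAt (ekMinus 1 ψ) ((-1 * 2 * t) • ψ t) t := by
  refine ae_restrict_Ioi_of_forall_Ioo fun a b ha hab => ?_
  have h0 := ekMinusExists_one.1 (hψ a ha)
  filter_upwards [ae_hasDerivAt_setIntegral_Ioc hab.le (h0.mono_set Ioc_subset_Ioi_self)]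
    with t ht hmem
  rw [funext (ekMinus_one ψ), neg_one_mul, neg_mul, neg_smul, mul_smul, ← smul_neg]
  exact (hasDerivAt_setIntegral_Ioi_of_Ioc h0 hmem.1 (ht hmem)).const_smul (2 : ℝ)

theorem continuousAt_ekMinus_one (hψ : ∀ t, 0 < t → EKMinusExists 1 ψ t) {t : ℝ} (ht : 0 < t) :
    ContinuousAt (ekMinus 1 ψ) t := by
  -- The base point `t / 2` makes `t` interior, so that the tail integral near `t` is a constant
  -- minus a primitive.
  have h0 := ekMinusExists_one.1 (hψ (t / 2) (by linarith))
  have h1 := ((continuousOn_setIntegral_Ioc (b := t + 1)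
    (h0.mono_set Ioc_subset_Ioi_self)).continuousAt
    (Ioo_mem_nhds (by linarith) (by linarith) : _ ∈ nhds t)).const_sub
      (∫ r in Ioi (t / 2), r • ψ r)
  rw [funext (ekMinus_one ψ)]
  refine ContinuousAt.const_smul (ContinuousAt.congr (f := fun x => (∫ r in Ioi (t / 2), r • ψ r) -
    ∫ r in Ioc (t / 2) x, r • ψ r) h1 ?_) (2 : ℝ)
  filter_upwards [Ioi_mem_nhds (show t / 2 < t by linarith)] with x hx
  rw [setIntegral_Ioi_eq_sub h0 (le_of_lt hx)]

end OrderOne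

/-! ### Iterated derivatives -/

theorem ekD_of_hasDerivAt {F G : ℝ → ℂ} {ε c t : ℝ} {z : ℂ} (ht : 0 < t)
    (hF : ∀ s, 0 < s → F s = c • G s) (hG : HasDerivAt G ((ε * 2 * t) • z) t) :
    DifferentiableAt ℝ F t ∧ ekD F t = (ε * c) • z := by
  have h1 : HasDerivAt F (c • ((ε * 2 * t) • z)) t := by
    refine (hG.const_smul c).congr_of_eventuallyEq ?_
    filter_upwards [Ioi_mem_nhds ht] with s hs
    exact hF s hs
  refine ⟨h1.differentiableAt, ?_⟩
  rw [ekD, h1.deriv, smul_smul, smul_smul]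
  congr 1
  field_simp

/-- `D` moves down the ladder `J M, …, J 0`, with `ε = 1` for left-sided and `ε = -1` for
right-sided integrals. Only the bottom rung, where `J 0` may be discontinuous, is restricted to
almost every `t`. -/
theorem ekD_iterate_of_chain {M : ℕ} (hM : 1 ≤ M) {J : ℕ → ℝ → ℂ} {ε : ℝ}
    (h1 : ∀ i, 1 ≤ i → i < M → ∀ t, 0 < t → HasDerivAt (J (i + 1)) ((ε * 2 * t) • J i t) t)
    (h0 : ∀ᵐ t ∂(volume.restrict (Ioi (0 : ℝ))), HasDerivAt (J 1) ((ε * 2 * t) • J 0 t) t)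
    {F : ℝ → ℂ} {c : ℝ} (hF : ∀ t, 0 < t → F t = c • J M t) :
    EKDExists M F ∧
    (∀ᵐ t ∂(volume.restrict (Ioi (0 : ℝ))), ekD^[M] F t = (ε ^ M * c) • J 0 t) ∧
    ((∀ t, 0 < t → HasDerivAt (J 1) ((ε * 2 * t) • J 0 t) t) →
      ∀ t, 0 < t → ekD^[M] F t = (ε ^ M * c) • J 0 t) := by
  induction M, hM using Nat.le_induction generalizing F c with
  | base =>
    refine ⟨⟨fun i hi => by omega, fun i hi => ?_⟩, ?_, fun h t ht => ?_⟩
    · obtain rfl : i = 0 := by omega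
      filter_upwards [h0, ae_restrict_mem measurableSet_Ioi] with t ht ht0
      exact (ekD_of_hasDerivAt ht0 hF ht).1
    · filter_upwards [h0, ae_restrict_mem measurableSet_Ioi] with t ht ht0
      simpa using (ekD_of_hasDerivAt ht0 hF ht).2
    · simpa using (ekD_of_hasDerivAt ht hF (h t ht)).2
  | succ M hM ih =>
    have hD := fun t ht => ekD_of_hasDerivAt ht hF (h1 M hM (Nat.lt_succ_self M) t ht)
    -- One derivative is taken off the inside of the iterate, so the induction must allow arbitrary
    -- `F` and `c`.
    obtain ⟨⟨ih1, ih2⟩, ih3, ih4⟩ := ih (fun i hi hiM => h1 i hi (hiM.trans (Nat.lt_succ_self M)))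
      (F := ekD F) (c := ε * c) (fun t ht => (hD t ht).2)
    rw [← mul_assoc, ← pow_succ] at ih3 ih4
    refine ⟨⟨fun i hi t ht => ?_, fun i hi => ?_⟩, ih3, ih4⟩
    · cases i with
      | zero => exact (hD t ht).1
      | succ i => exact ih1 i (by omega) t ht
    · cases i with
      | zero =>
        filter_upwards [ae_restrict_mem measurableSet_Ioi] with t ht
        exact (hD t ht).1
      | succ i => exact ih2 i (by omega)

section Plus

variable {φ : ℝ → ℂ}

theorem ekPlus_nat_succ (hφ : ∀ t, 0 < t → EKPlusExists 1 φ t) {i : ℕ} (hi : 1 ≤ i) {t : ℝ}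
    (ht : 0 < t) :
    EKPlusExists 1 (ekPlus i φ) t ∧ ekPlus 1 (ekPlus i φ) t = ekPlus ((i + 1 : ℕ) : ℝ) φ t := by
  have hi' : (1 : ℝ) ≤ i := by exact_mod_cast hi
  have := ekPlus_comp (α := i) (β := 1) (by linarith) one_pos (by linarith) ht
    (ekPlusExists_one.1 (hφ t ht))
  push_cast
  exact this.2

theorem hasDerivAt_ekPlus_nat_succ (hφ : ∀ t, 0 < t → EKPlusExists 1 φ t) {i : ℕ} (hi : 1 ≤ i)
    {t : ℝ} (ht : 0 < t) (hc : ContinuousAt (ekPlus i φ) t) :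
    HasDerivAt (ekPlus ((i + 1 : ℕ) : ℝ) φ) ((1 * 2 * t) • ekPlus i φ t) t := by
  refine (hasDerivAt_ekPlus_one (fun s hs => (ekPlus_nat_succ hφ hi hs).1) ht
    hc).congr_of_eventuallyEq ?_
  filter_upwards [Ioi_mem_nhds ht] with s hs
  exact (ekPlus_nat_succ hφ hi hs).2.symm

theorem continuousAt_ekPlus_nat (hφ : ∀ t, 0 < t → EKPlusExists 1 φ t) {i : ℕ} (hi : 1 ≤ i)
    {t : ℝ} (ht : 0 < t) : ContinuousAt (ekPlus i φ) t := by
  induction i, hi using Nat.le_induction with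
  | base => simpa using continuousAt_ekPlus_one hφ ht
  | succ i hi ih => exact (hasDerivAt_ekPlus_nat_succ hφ hi ht ih).continuousAt

theorem ekD_iterate_ekPlus (hφ : ∀ t, 0 < t → EKPlusExists 1 φ t) {M : ℕ} (hM : 1 ≤ M)
    {F : ℝ → ℂ} {c : ℝ} (hF : ∀ t, 0 < t → F t = c • ekPlus M φ t) :
    EKDExists M F ∧ (∀ᵐ t ∂(volume.restrict (Ioi (0 : ℝ))), ekD^[M] F t = c • φ t) ∧
    ((∀ t, 0 < t → ContinuousAt φ t) → ∀ t, 0 < t → ekD^[M] F t = c • φ t) := by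
  -- Order zero must be put in by hand: `Real.Gamma 0 = 0`, so `ekPlus 0 φ` is zero and not `φ`.
  have := ekD_iterate_of_chain (M := M) hM (J := fun i => if i = 0 then φ else ekPlus i φ) (ε := 1)
    (fun i hi _ t ht => by
      simp only [Nat.succ_ne_zero, if_false, show i ≠ 0 by omega]
      exact hasDerivAt_ekPlus_nat_succ hφ hi ht (continuousAt_ekPlus_nat hφ hi ht))
    (by simpa using ae_hasDerivAt_ekPlus_one hφ) (F := F) (c := c)
    (by simpa [show M ≠ 0 by omega] using hF)
  simp only [one_pow, one_mul, if_true, one_ne_zero, if_false, Nat.cast_one] at this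
  exact ⟨this.1, this.2.1, fun hc => this.2.2 fun t ht => by
    simpa using hasDerivAt_ekPlus_one hφ ht (hc t ht)⟩

end Plus

section Minus

variable {g : ℝ → ℂ}

theorem ekMinus_nat_succ (hg : AEStronglyMeasurable g (volume.restrict (Ioi 0))) {i : ℕ}
    (hi : 1 ≤ i) (hex : ∀ t, 0 < t → EKMinusExists ((i + 1 : ℕ) : ℝ) g t) {t : ℝ} (ht : 0 < t) :
    EKMinusExists 1 (ekMinus i g) t ∧
      ekMinus 1 (ekMinus i g) t = ekMinus ((i + 1 : ℕ) : ℝ) g t := by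
  have hi' : (1 : ℝ) ≤ i := by exact_mod_cast hi
  have h := hex t ht
  push_cast at h ⊢
  exact (ekMinus_ekMinus (by linarith) one_pos ht.le
    (hg.mono_measure (Measure.restrict_mono (Ioi_subset_Ioi ht.le) le_rfl)) h).2

theorem hasDerivAt_ekMinus_nat_succ (hg : AEStronglyMeasurable g (volume.restrict (Ioi 0))) {i : ℕ}
    (hi : 1 ≤ i) (hex : ∀ t, 0 < t → EKMinusExists ((i + 1 : ℕ) : ℝ) g t) {t : ℝ} (ht : 0 < t)
    (hc : ContinuousAt (ekMinus i g) t) :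
    HasDerivAt (ekMinus ((i + 1 : ℕ) : ℝ) g) ((-1 * 2 * t) • ekMinus i g t) t := by
  refine (hasDerivAt_ekMinus_one (fun s hs => (ekMinus_nat_succ hg hi hex hs).1) ht
    hc).congr_of_eventuallyEq ?_
  filter_upwards [Ioi_mem_nhds ht] with s hs
  exact (ekMinus_nat_succ hg hi hex hs).2.symm

theorem continuousAt_ekMinus_nat (hg : AEStronglyMeasurable g (volume.restrict (Ioi 0))) {M : ℕ}
    (hex : ∀ i : ℕ, 1 ≤ i → i ≤ M → ∀ t, 0 < t → EKMinusExists i g t) {i : ℕ} (hi : 1 ≤ i)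
    (hiM : i ≤ M) {t : ℝ} (ht : 0 < t) : ContinuousAt (ekMinus i g) t := by
  induction i, hi using Nat.le_induction with
  | base => simpa using continuousAt_ekMinus_one (by simpa using hex 1 le_rfl hiM) ht
  | succ i hi ih =>
    exact (hasDerivAt_ekMinus_nat_succ hg hi (hex (i + 1) (by omega) hiM) ht
      (ih (by omega))).continuousAt

theorem ekD_iterate_ekMinus (hg : AEStronglyMeasurable g (volume.restrict (Ioi 0))) {M : ℕ}
    (hM : 1 ≤ M) (hex : ∀ i : ℕ, 1 ≤ i → i ≤ M → ∀ t, 0 < t → EKMinusExists i g t)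
    {F : ℝ → ℂ} {c : ℝ} (hF : ∀ t, 0 < t → F t = c • ekMinus M g t) :
    EKDExists M F ∧
    ∀ᵐ t ∂(volume.restrict (Ioi (0 : ℝ))), ekD^[M] F t = ((-1) ^ M * c) • g t := by
  have := ekD_iterate_of_chain (M := M) hM (J := fun i => if i = 0 then g else ekMinus i g)
    (ε := -1) (fun i hi hiM t ht => by
      simp only [Nat.succ_ne_zero, if_false, show i ≠ 0 by omega]
      exact hasDerivAt_ekMinus_nat_succ hg hi (hex (i + 1) (by omega) hiM) ht
        (continuousAt_ekMinus_nat hg hex hi hiM.le ht))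
    (by simpa using ae_hasDerivAt_ekMinus_one (by simpa using hex 1 le_rfl hM)) (F := F) (c := c)
    (by simpa [show M ≠ 0 by omega] using hF)
  exact ⟨this.1, by simpa using this.2.1⟩

end Minus

/-! ### Analysis of the profile -/

/-- The integrability of a radial profile near the origin and at infinity. -/
structure RadialIntegrable (n j k : ℕ) (f₀ : ℝ → ℂ) : Prop where
  aesm : AEStronglyMeasurable f₀ (volume.restrict (Ioi 0))
  near : ∀ S : ℝ, 0 < S → IntegrableOn (fun r => r ^ (n - j - 1) • f₀ r) (Ioc 0 S)
  far : ∀ a : ℝ, 0 < a → IntegrableOn (fun r => r ^ (k - 1) • f₀ r) (Ioi a)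

/-- For integer order at least one the kernel has no singularity at `r = t` and is at most
`r^{2i-1}`, which on `(t, ∞)` is bounded by a constant times `r^p`. The integral thus converges at
every `t`. -/
theorem ekMinusExists_nat_of_far {g : ℝ → ℂ} {p i : ℕ} (hi : 1 ≤ i) (hip : 2 * i - 1 ≤ p) {t : ℝ}
    (ht : 0 < t) (hg : IntegrableOn (fun r => r ^ p • g r) (Ioi t)) : EKMinusExists i g t := by
  have hi' : (1 : ℝ) ≤ i := by exact_mod_cast hi
  have h := Integrable.bdd_smul (φ := fun r : ℝ => (r ^ 2 - t ^ 2) ^ ((i : ℝ) - 1) * r / r ^ p) hg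
    (t ^ (p - (2 * i - 1)))⁻¹ (Measurable.aestronglyMeasurable (by fun_prop)) (by
      filter_upwards [ae_restrict_mem measurableSet_Ioi] with r hr
      have hr0 : 0 < r := ht.trans hr
      have h2 : 0 ≤ r ^ 2 - t ^ 2 := by nlinarith [show t < r from hr]
      rw [Real.norm_of_nonneg (by positivity)]
      calc (r ^ 2 - t ^ 2) ^ ((i : ℝ) - 1) * r / r ^ p
          ≤ (r ^ 2) ^ ((i : ℝ) - 1) * r / r ^ p := by
            gcongr
            nlinarith
        _ = (r ^ (p - (2 * i - 1)))⁻¹ := by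
            rw [show (i : ℝ) - 1 = ((i - 1 : ℕ) : ℝ) by push_cast [hi]; ring, Real.rpow_natCast,
              ← pow_mul, ← pow_succ, show 2 * (i - 1) + 1 = 2 * i - 1 by omega]
            rw [div_eq_iff (by positivity), eq_inv_mul_iff_mul_eq₀ (by positivity), ← pow_add,
              Nat.sub_add_cancel hip]
        _ ≤ _ := by
            gcongr
            exact le_of_lt hr)
  refine IntegrableOn.congr_fun h (fun r hr => ?_) measurableSet_Ioi
  have hr0 : 0 < r := ht.trans hr
  simp only [Pi.smul_apply']
  rw [smul_smul, div_mul_cancel₀ _ (by positivity)]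

/-! ### Congruence and scaling of the fractional integrals -/

theorem ekPlus_congr {α t : ℝ} {φ ψ : ℝ → ℂ} (h : ∀ r, 0 < r → φ r = ψ r) :
    ekPlus α φ t = ekPlus α ψ t := by
  rw [ekPlus, ekPlus]
  congr 1
  refine setIntegral_congr_fun measurableSet_Ioc fun r hr => ?_
  rw [h r hr.1]

theorem EKPlusExists.congr {α t : ℝ} {φ ψ : ℝ → ℂ} (hφ : EKPlusExists α φ t)
    (h : ∀ r, 0 < r → φ r = ψ r) : EKPlusExists α ψ t := by
  refine IntegrableOn.congr_fun hφ (fun r hr => ?_) measurableSet_Ioc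
  rw [h r hr.1]

theorem ae_restrict_Ioi_mono {p : ℝ → Prop} {t : ℝ} (ht : 0 ≤ t)
    (h : ∀ᵐ r ∂(volume.restrict (Ioi (0 : ℝ))), p r) : ∀ᵐ r ∂(volume.restrict (Ioi t)), p r :=
  ae_restrict_of_ae_restrict_of_subset (Ioi_subset_Ioi ht) h

theorem ekMinus_congr {α t : ℝ} {φ ψ : ℝ → ℂ} (ht : 0 ≤ t)
    (h : ∀ᵐ r ∂(volume.restrict (Ioi (0 : ℝ))), φ r = ψ r) : ekMinus α φ t = ekMinus α ψ t := by
  rw [ekMinus, ekMinus]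
  congr 1
  refine integral_congr_ae ?_
  filter_upwards [ae_restrict_Ioi_mono ht h] with r hr
  rw [hr]

theorem EKMinusExists.congr {α t : ℝ} {φ ψ : ℝ → ℂ} (ht : 0 ≤ t) (hφ : EKMinusExists α φ t)
    (h : ∀ᵐ r ∂(volume.restrict (Ioi (0 : ℝ))), φ r = ψ r) : EKMinusExists α ψ t := by
  refine Integrable.congr hφ ?_
  filter_upwards [ae_restrict_Ioi_mono ht h] with r hr
  rw [hr]

theorem ekPlus_smul (α c t : ℝ) (φ : ℝ → ℂ) :
    ekPlus α (fun r => c • φ r) t = c • ekPlus α φ t := by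
  simp_rw [ekPlus, smul_comm _ c, integral_smul]
  rw [smul_comm]

theorem ekMinus_smul (α c t : ℝ) (φ : ℝ → ℂ) :
    ekMinus α (fun r => c • φ r) t = c • ekMinus α φ t := by
  simp_rw [ekMinus, smul_comm _ c, integral_smul]
  rw [smul_comm]

theorem EKPlusExists.smul {α t : ℝ} {φ : ℝ → ℂ} (h : EKPlusExists α φ t) (c : ℝ) :
    EKPlusExists α (fun r => c • φ r) t := by
  simp_rw [EKPlusExists, smul_comm _ c]
  exact Integrable.smul c h

theorem EKMinusExists.smul {α t : ℝ} {φ : ℝ → ℂ} (h : EKMinusExists α φ t) (c : ℝ) :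
    EKMinusExists α (fun r => c • φ r) t := by
  simp_rw [EKMinusExists, smul_comm _ c]
  exact Integrable.smul c h

theorem cTilde_pos {n j k : ℕ} (hjk : j + k < n) : 0 < cTilde n j k := by
  have h : (j : ℝ) + k < n := by exact_mod_cast hjk
  have hj : (0 : ℝ) ≤ j := j.cast_nonneg
  have h1 := Real.Gamma_pos_of_pos (show 0 < ((n : ℝ) - k) / 2 by linarith)
  have h2 := Real.Gamma_pos_of_pos (show 0 < ((n : ℝ) - j - k) / 2 by linarith)
  have := Real.pi_pos
  rw [cTilde]
  positivity

theorem sq_rpow_half_sub_one {x : ℝ} (hx : 0 < x) (d : ℕ) (hd : 1 ≤ d) :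
    (x ^ 2) ^ ((d : ℝ) / 2 - 1) * x = x ^ (d - 1) := by
  rw [← Real.rpow_natCast x 2, ← Real.rpow_mul hx.le, ← Real.rpow_add_one hx.ne',
    ← Real.rpow_natCast x (d - 1)]
  congr 1
  push_cast [hd]
  ring

/-! ### Existence of the profile and its inversion -/

namespace RadialIntegrable

variable {n j k : ℕ} {f₀ : ℝ → ℂ}

/-- After Fubini, `f₀(r)` is weighted by the integral over `x < min(S, r)` of `x^{n-j-k-1} (r² -
x²)^{k/2-1} r`. For `r ≤ 2S` this is at most a full Beta integral, a multiple of `r^{n-j-1}`. For `r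
> 2S` the factor `r² - x²` is comparable to `r²` and the bound is a multiple of `r^{k-1}`. These are
the two weights in `RadialIntegrable`. -/
theorem inner_aux (hk : 1 ≤ k) (hjk : j + k < n) (H : RadialIntegrable n j k f₀) {S : ℝ}
    (hS : 0 < S) : (∀ᵐ x ∂(volume.restrict (Ioc 0 S)), EKMinusExists ((k : ℝ) / 2) f₀ x) ∧
      IntegrableOn (fun x => x • innerProfile n j k f₀ x) (Ioc 0 S) := by
  obtain ⟨d, rfl⟩ : ∃ d, n = d + 1 + j + k := ⟨n - j - k - 1, by omega⟩
  have hk2 : (0 : ℝ) < (k : ℝ) / 2 := by positivity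
  have hd2 : (0 : ℝ) < ((d + 1 : ℕ) : ℝ) / 2 := by positivity
  have hGk := Real.Gamma_pos_of_pos hk2
  have hB := beta_pos hd2 hk2
  set K : ℝ → ℝ → ℝ := fun x r => if 0 < x ∧ x < r then
    x ^ d * ((r ^ 2 - x ^ 2) ^ ((k : ℝ) / 2 - 1) * r) else 0 with hK
  set C₁ := beta (((d + 1 : ℕ) : ℝ) / 2) ((k : ℝ) / 2) / 2
  set C₂ := S ^ d * 2 * S
  set κ : ℝ → ℝ := fun r => if r ≤ 2 * S then C₁ * r ^ (d + 1 + j + k - j - 1) else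
    C₂ * r ^ (k - 1) with hκ
  have hKm : Measurable (Function.uncurry K) := by
    refine Measurable.ite ?_ (by fun_prop) measurable_const
    exact ((measurableSet_lt measurable_const measurable_fst).inter
      (measurableSet_lt measurable_fst measurable_snd))
  have hK0 : ∀ x r, 0 ≤ K x r := by
    intro x r
    simp only [hK]
    split_ifs with h
    · have h1 := h.1
      have h3 : 0 ≤ r ^ 2 - x ^ 2 := by nlinarith [h.2]
      have := h.1.trans h.2
      positivity
    · exact le_rfl
  have hκ0 : ∀ᵐ r ∂(volume.restrict (Ioi 0)), 0 ≤ κ r := by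
    filter_upwards [ae_restrict_mem measurableSet_Ioi] with r hr
    have : (0 : ℝ) < r := hr
    simp only [hκ]
    split_ifs <;> positivity
  have hker : ∀ᵐ r ∂(volume.restrict (Ioi 0)),
      ∫⁻ x in Ioc 0 S, ENNReal.ofReal (K x r) ≤ ENNReal.ofReal (κ r) := by
    filter_upwards [ae_restrict_mem measurableSet_Ioi] with r hr
    have hr0 : (0 : ℝ) < r := hr
    simp only [hκ]
    split_ifs with hrS
    · calc ∫⁻ x in Ioc 0 S, ENNReal.ofReal (K x r)
          ≤ ∫⁻ x, (Ioo 0 r).indicator (fun x => ENNReal.ofReal (r *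
              ((x ^ 2 - 0 ^ 2) ^ (((d + 1 : ℕ) : ℝ) / 2 - 1) *
                (r ^ 2 - x ^ 2) ^ ((k : ℝ) / 2 - 1) * x))) x := by
            refine (setLIntegral_le_lintegral _ _).trans (lintegral_mono fun x => ?_)
            by_cases hx : x ∈ Ioo 0 r
            · rw [indicator_of_mem hx]
              simp only [hK]
              rw [if_pos (show 0 < x ∧ x < r from hx), mul_right_comm _ _ x, zero_pow two_ne_zero,
                sub_zero, sq_rpow_half_sub_one hx.1 (d + 1) (by omega)]
              simp only [add_tsub_cancel_right]
              exact (congrArg _ (by ring)).le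
            · simp only [hK]
              rw [if_neg (show ¬ (0 < x ∧ x < r) from hx)]
              simp
        _ = ENNReal.ofReal (C₁ * r ^ (d + 1 + j + k - j - 1)) := by
            rw [lintegral_indicator measurableSet_Ioo]
            simp_rw [ENNReal.ofReal_mul hr0.le]
            rw [lintegral_const_mul' _ _ ENNReal.ofReal_ne_top,
              lintegral_beta_sq hd2 hk2 le_rfl hr0, ← ENNReal.ofReal_mul hr0.le]
            rw [zero_pow two_ne_zero, sub_zero, show d + 1 + j + k - j - 1 = (d + 1 + k) - 1 by omega,
              ← sq_rpow_half_sub_one hr0 (d + 1 + k) (by omega)]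
            simp only [C₁]
            push_cast
            ring_nf
    · have hrS' : 2 * S < r := not_le.1 hrS
      calc ∫⁻ x in Ioc 0 S, ENNReal.ofReal (K x r)
          ≤ ∫⁻ x in Ioc 0 S, ENNReal.ofReal (S ^ d * (2 * r ^ (k - 1))) := by
            refine setLIntegral_mono' measurableSet_Ioc fun x hx => ?_
            refine ENNReal.ofReal_le_ofReal ?_
            have hx0 := hx.1
            have hxS := hx.2
            have h4 : r ^ 2 / 2 ≤ r ^ 2 - x ^ 2 := by nlinarith
            have h5 : 0 < r ^ 2 - x ^ 2 := by nlinarith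
            simp only [hK]
            rw [if_pos ⟨hx0, by linarith⟩]
            refine mul_le_mul (by gcongr) ?_ (by positivity) (by positivity)
            -- The exponent `k/2 - 1` is negative for `k = 1`, so the power is split into a
            -- numerator bounded above and a denominator bounded below.
            calc (r ^ 2 - x ^ 2) ^ ((k : ℝ) / 2 - 1) * r
                = (r ^ 2 - x ^ 2) ^ ((k : ℝ) / 2) / (r ^ 2 - x ^ 2) * r := by
                  rw [Real.rpow_sub_one h5.ne']
              _ ≤ (r ^ 2) ^ ((k : ℝ) / 2) / (r ^ 2 / 2) * r := by
                  gcongr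
                  nlinarith
              _ = 2 * ((r ^ 2) ^ ((k : ℝ) / 2 - 1) * r) := by
                  rw [Real.rpow_sub_one (by positivity)]
                  field_simp
              _ = _ := by rw [sq_rpow_half_sub_one hr0 k hk]
        _ = ENNReal.ofReal (C₂ * r ^ (k - 1)) := by
            rw [setLIntegral_const, Real.volume_Ioc, sub_zero, ← ENNReal.ofReal_mul (by positivity)]
            congr 1
            simp only [C₂]
            ring
  have hint : IntegrableOn (fun r => κ r • f₀ r) (Ioi 0) := by
    rw [← Ioc_union_Ioi_eq_Ioi (show (0 : ℝ) ≤ 2 * S by positivity)]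
    refine IntegrableOn.union ?_ ?_
    · refine IntegrableOn.congr_fun ((H.near (2 * S) (by positivity)).smul C₁) (fun r hr => ?_)
        measurableSet_Ioc
      simp only [hκ, Pi.smul_apply]
      rw [if_pos hr.2, mul_smul]
    · refine IntegrableOn.congr_fun ((H.far (2 * S) (by positivity)).smul C₂) (fun r hr => ?_)
        measurableSet_Ioi
      simp only [hκ]
      rw [if_neg (not_le.2 hr), mul_smul C₂]
      rfl
  have hslice : ∀ x ∈ Ioc 0 S, ∀ r, r ∈ Ioi (0 : ℝ) → K x r • f₀ r =
      (Ioi x).indicator (fun r => x ^ d • (((r ^ 2 - x ^ 2) ^ ((k : ℝ) / 2 - 1) * r) • f₀ r)) r := by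
    intro x hx r hr
    by_cases hrx : x < r
    · rw [indicator_of_mem (show r ∈ Ioi x from hrx)]
      simp only [hK]
      rw [if_pos ⟨hx.1, hrx⟩, mul_smul]
    · rw [indicator_of_notMem (show r ∉ Ioi x from hrx)]
      simp only [hK]
      rw [if_neg (fun h => hrx h.2), zero_smul]
  have hprod := integrable_kernel_prod hKm hK0 hker hκ0 H.aesm hint
  constructor
  · filter_upwards [hprod.prod_right_ae, ae_restrict_mem measurableSet_Ioc] with x hx hxS
    have h1 : IntegrableOn ((Ioi x).indicator
        (fun r => x ^ d • (((r ^ 2 - x ^ 2) ^ ((k : ℝ) / 2 - 1) * r) • f₀ r))) (Ioi 0) :=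
      IntegrableOn.congr_fun hx (hslice x hxS) measurableSet_Ioi
    rw [IntegrableOn, integrable_indicator_iff measurableSet_Ioi, IntegrableOn,
      Measure.restrict_restrict measurableSet_Ioi,
      inter_eq_left.2 (Ioi_subset_Ioi hxS.1.le)] at h1
    exact integrableOn_of_const_smul (pow_pos hxS.1 d).ne' h1
  · refine integrableOn_of_const_smul (c := Real.Gamma ((k : ℝ) / 2) / 2) (by positivity)
      (IntegrableOn.congr_fun hprod.integral_prod_left (fun x hx => ?_) measurableSet_Ioc)
    simp only
    rw [setIntegral_congr_fun measurableSet_Ioi (hslice x hx), setIntegral_indicator measurableSet_Ioi,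
      inter_eq_right.2 (Ioi_subset_Ioi hx.1.le), integral_smul, innerProfile, ekMinus, smul_smul,
      smul_smul, smul_smul]
    congr 1
    have h1 : x * x ^ (((d + 1 + j + k : ℕ) : ℤ) - j - k - 2) = x ^ d := by
      rw [← zpow_one_add₀ hx.1.ne', ← zpow_natCast]
      congr 1
      push_cast
      ring
    rw [mul_assoc _ x, h1]
    field_simp

theorem ae_ekMinusExists (hk : 1 ≤ k) (hjk : j + k < n) (H : RadialIntegrable n j k f₀) :
    ∀ᵐ r ∂(volume.restrict (Ioi (0 : ℝ))), EKMinusExists ((k : ℝ) / 2) f₀ r := by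
  refine ae_restrict_Ioi_of_forall_Ioo fun a b ha hab => ?_
  filter_upwards [(ae_restrict_iff' measurableSet_Ioc).1 (H.inner_aux hk hjk (ha.trans hab)).1]
    with t ht hmem
  exact ht ⟨ha.trans hmem.1, hmem.2.le⟩

theorem ekPlusExists_one_innerProfile (hk : 1 ≤ k) (hjk : j + k < n)
    (H : RadialIntegrable n j k f₀) : ∀ t, 0 < t → EKPlusExists 1 (innerProfile n j k f₀) t :=
  fun _ ht => ekPlusExists_one.2 (H.inner_aux hk hjk ht).2

theorem ae_ekPlusExists (hj : 1 ≤ j) (hk : 1 ≤ k) (hjk : j + k < n)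
    (H : RadialIntegrable n j k f₀) :
    ∀ᵐ s ∂(volume.restrict (Ioi (0 : ℝ))),
      EKPlusExists ((j : ℝ) / 2) (innerProfile n j k f₀) s := by
  refine ae_restrict_Ioi_of_forall_Ioo fun a b ha hab => ?_
  have hj2 : (0 : ℝ) < (j : ℝ) / 2 := by positivity
  have := (ekPlus_comp hj2 one_pos (by linarith) (ha.trans hab)
    (H.inner_aux hk hjk (ha.trans hab)).2).1
  filter_upwards [(ae_restrict_iff' measurableSet_Ioc).1 this] with t ht hmem
  exact ht ⟨ha.trans hmem.1, hmem.2.le⟩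

theorem stepOne_eq {s : ℝ} (hs : 0 < s) :
    stepOne n j k f₀ s = cTilde n j k • ekPlus ((j : ℝ) / 2) (innerProfile n j k f₀) s := by
  rw [stepOne, profile, smul_smul, mul_div_cancel₀ _ (zpow_pos hs _).ne']

/-- Composing with order `1 - (α - m)` completes `I^{j/2}_{+,2}` to the integer order `m + 1`, which
`D^{m+1}` undoes; for even `j` the completing order is `1`. The everywhere version is needed for
even `k`, where the result is differentiated directly and equality almost everywhere would not do.
-/
theorem plus_part (hj : 1 ≤ j) (hk : 1 ≤ k) (hjk : j + k < n) (H : RadialIntegrable n j k f₀) :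
    EKDerivPlusExists ((j : ℝ) / 2) (stepOne n j k f₀) ∧
    (∀ᵐ t ∂(volume.restrict (Ioi (0 : ℝ))), ekDerivPlus ((j : ℝ) / 2) (stepOne n j k f₀) t =
      cTilde n j k • innerProfile n j k f₀ t) ∧
    ((∀ t, 0 < t → ContinuousAt (innerProfile n j k f₀) t) → ∀ t, 0 < t →
      ekDerivPlus ((j : ℝ) / 2) (stepOne n j k f₀) t = cTilde n j k • innerProfile n j k f₀ t) := by
  have hj2 : (0 : ℝ) < (j : ℝ) / 2 := by positivity
  set α := (j : ℝ) / 2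
  set m := ⌊α⌋₊
  have hm : α < m + 1 := Nat.lt_floor_add_one α
  have hβ : 0 < 1 - (α - m) := by linarith
  have hαβ : α + (1 - (α - m)) = ((m + 1 : ℕ) : ℝ) := by push_cast; ring
  have hcomp := fun t (ht : 0 < t) => ekPlus_comp hj2 hβ
    (by rw [hαβ]; push_cast; linarith [m.cast_nonneg (α := ℝ)]) ht (H.inner_aux hk hjk ht).2
  have hF : ∀ t, 0 < t → ekPlus (1 - (α - m)) (stepOne n j k f₀) t =
      cTilde n j k • ekPlus ((m + 1 : ℕ) : ℝ) (innerProfile n j k f₀) t := by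
    intro t ht
    rw [ekPlus_congr fun r hr => stepOne_eq hr, ekPlus_smul, (hcomp t ht).2.2, hαβ]
  have hD := ekD_iterate_ekPlus (H.ekPlusExists_one_innerProfile hk hjk) (M := m + 1) (by omega) hF
  exact ⟨⟨fun t ht => ((hcomp t ht).2.1.smul _).congr fun r hr => (stepOne_eq hr).symm, hD.1⟩, hD.2⟩

theorem smul_innerProfile (c : ℝ) {r : ℝ} (hr : 0 < r) :
    (r ^ (2 - (n : ℤ) + j + k)) • c • innerProfile n j k f₀ r = c • ekMinus ((k : ℝ) / 2) f₀ r := by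
  rw [innerProfile, smul_comm, smul_smul _ _ (ekMinus _ _ _), ← zpow_add₀ hr.ne',
    show 2 - (n : ℤ) + j + k + (n - j - k - 2) = 0 by ring, zpow_zero, one_smul]

/-- For even `k` the function `I^{k/2}_{-,2} f₀` has positive integer order and is continuous, so
`stepTwo` is known at every point and `D` may be applied. For odd `k` the integral of order `1/2`
comes before `D`, and it sees only the almost everywhere class of `stepTwo`. -/
theorem minus_part (hj : 1 ≤ j) (hk : 1 ≤ k) (hjk : j + k < n) (H : RadialIntegrable n j k f₀) :
    EKDerivMinusExists ((k : ℝ) / 2) (stepTwo n j k f₀) ∧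
    ∀ᵐ t ∂(volume.restrict (Ioi (0 : ℝ))),
      ekDerivMinus ((k : ℝ) / 2) (stepTwo n j k f₀) t = cTilde n j k • f₀ t := by
  have hP := (H.plus_part hj hk hjk).2
  set c := cTilde n j k
  have hfl : ⌊(k : ℝ) / 2⌋₊ = k / 2 := by
    have := Nat.floor_div_natCast (k : ℝ) 2
    simpa using this
  have hsgn : ∀ (M : ℕ) (z : ℂ), (-1) ^ M * (((-1 : ℝ) ^ M * c) • z) = c • z := by
    intro M z
    rw [Complex.real_smul, Complex.real_smul]
    push_cast
    rw [← mul_assoc, ← mul_assoc, ← mul_pow]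
    simp
  rcases Nat.even_or_odd' k with ⟨M, hM | hM⟩
  · have hM1 : 1 ≤ M := by omega
    have hflM : ⌊(k : ℝ) / 2⌋₊ = M := by rw [hfl]; omega
    have hα : (k : ℝ) / 2 = M := by rw [hM]; push_cast; ring
    have hex : ∀ i : ℕ, 1 ≤ i → i ≤ M → ∀ t, 0 < t → EKMinusExists i f₀ t := fun i hi hiM t ht =>
      ekMinusExists_nat_of_far hi (by omega) ht (H.far t ht)
    have hcont : ∀ t, 0 < t → ContinuousAt (innerProfile n j k f₀) t := by
      intro t ht
      have := continuousAt_ekMinus_nat H.aesm hex hM1 le_rfl ht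
      rw [← hα] at this
      exact (continuousAt_zpow₀ _ _ (Or.inl ht.ne')).smul this
    have hF : ∀ t, 0 < t → stepTwo n j k f₀ t = c • ekMinus (M : ℝ) f₀ t := by
      intro t ht
      rw [stepTwo, hP.2 hcont t ht, smul_innerProfile c ht, hα]
    have hD := ekD_iterate_ekMinus H.aesm hM1 hex hF
    have hαfl : (k : ℝ) / 2 = ⌊(k : ℝ) / 2⌋₊ := by rw [hflM, hα]
    refine ⟨⟨fun _ => by rw [hflM]; exact hD.1, fun h => absurd hαfl h⟩, ?_⟩
    filter_upwards [hD.2] with t ht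
    rw [ekDerivMinus, if_pos hαfl, hflM, ht, hsgn]
  · have hflM : ⌊(k : ℝ) / 2⌋₊ = M := by rw [hfl]; omega
    have hα : (k : ℝ) / 2 = M + 1 / 2 := by rw [hM]; push_cast; ring
    have hαfl : (k : ℝ) / 2 ≠ ⌊(k : ℝ) / 2⌋₊ := by rw [hflM, hα]; norm_num
    have hα0 : (0 : ℝ) < (k : ℝ) / 2 := by positivity
    have e1 : 1 - (k : ℝ) / 2 + M = 1 / 2 := by rw [hα]; ring
    have e2 : -2 * (M : ℝ) - 2 = -2 * ((k : ℝ) / 2 + 1 / 2) := by rw [hα]; ring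
    have e3 : (k : ℝ) / 2 + 1 / 2 = ((M + 1 : ℕ) : ℝ) := by rw [hα]; push_cast; ring
    have hgm : AEStronglyMeasurable (fun r : ℝ => r⁻¹ • f₀ r) (volume.restrict (Ioi 0)) :=
      (measurable_inv.aestronglyMeasurable (f := fun r : ℝ => r⁻¹)).smul H.aesm
    have hex : ∀ i : ℕ, 1 ≤ i → i ≤ M + 1 → ∀ t, 0 < t →
        EKMinusExists i (fun r => r⁻¹ • f₀ r) t := fun i hi hiM t ht =>
      -- The factor `r⁻¹` raises the admissible power from `k - 1` to `k = 2M + 1`, just enough for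
      -- order `M + 1`.
      ekMinusExists_nat_of_far (p := k) hi (by omega) ht <| by
        refine IntegrableOn.congr_fun (H.far t ht) (fun r hr => ?_) measurableSet_Ioi
        have hr0 : 0 < r := ht.trans hr
        rw [smul_smul]
        congr 1
        rw [eq_mul_inv_iff_mul_eq₀ hr0.ne', ← pow_succ, Nat.sub_add_cancel hk]
    have hw := fun t (ht : 0 < t) => ekMinus_half_weighted hα0 ht
      (H.aesm.mono_measure (Measure.restrict_mono (Ioi_subset_Ioi ht.le) le_rfl))
      (by rw [e3]; exact hex (M + 1) (by omega) le_rfl t ht)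
    have hae : ∀ᵐ r ∂(volume.restrict (Ioi (0 : ℝ))),
        c • (r ^ (-2 * ((k : ℝ) / 2 + 1 / 2)) • ekMinus ((k : ℝ) / 2) f₀ r) =
        r ^ (-2 * (M : ℝ) - 2) • stepTwo n j k f₀ r := by
      filter_upwards [hP.1, ae_restrict_mem measurableSet_Ioi] with r hr hr0
      rw [stepTwo, hr, smul_innerProfile c hr0, e2, smul_comm]
    have hF : ∀ t, 0 < t → t ^ (2 * ((k : ℝ) / 2)) • ekMinus (1 / 2)
        (fun r : ℝ => r ^ (-2 * (M : ℝ) - 2) • stepTwo n j k f₀ r) t =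
        c • ekMinus ((M + 1 : ℕ) : ℝ) (fun r => r⁻¹ • f₀ r) t := by
      intro t ht
      rw [← ekMinus_congr ht.le hae, ekMinus_smul, smul_comm, (hw t ht).2, e3]
    have hD := ekD_iterate_ekMinus hgm (M := M + 1) (by omega) hex hF
    refine ⟨⟨fun h => absurd h hαfl, fun _ => ?_⟩, ?_⟩
    · rw [hflM, e1]
      exact ⟨fun t ht => ((hw t ht).1.smul c).congr ht.le hae, hD.1⟩
    · filter_upwards [hD.2, ae_restrict_mem measurableSet_Ioi] with t ht ht0
      have ht0' : (0 : ℝ) < t := ht0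
      -- The outer power in `𝒟^{k/2}_{-,2}` is `t`, which cancels the remaining `t⁻¹`.
      rw [ekDerivMinus, if_neg hαfl, hflM, e1, ht, hsgn, mul_one_div_cancel two_ne_zero, Real.rpow_one,
        smul_comm, smul_smul t, mul_inv_cancel₀ ht0'.ne', one_smul]

end RadialIntegrable

/-! ### Polar coordinates -/

/-- The surface area `2 π^{d/2} / Γ(d/2)` of the unit sphere in a `d`-dimensional space. -/
def sphereArea (d : ℕ) : ℝ := 2 * Real.pi ^ ((d : ℝ) / 2) / Real.Gamma ((d : ℝ) / 2)

theorem sphereArea_pos {d : ℕ} (hd : 1 ≤ d) : 0 < sphereArea d := by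
  have := Real.pi_pos
  have := Real.Gamma_pos_of_pos (show 0 < (d : ℝ) / 2 by positivity)
  rw [sphereArea]
  positivity

section Polar

variable {E : Type*} [NormedAddCommGroup E] [InnerProductSpace ℝ E] [FiniteDimensional ℝ E]
  [MeasurableSpace E] [BorelSpace E]

theorem finrank_mul_volume_ball {d : ℕ} (hd : Module.finrank ℝ E = d) (hd1 : 1 ≤ d) :
    (d : ENNReal) * volume (Metric.ball (0 : E) 1) = ENNReal.ofReal (sphereArea d) := by
  have : Nontrivial E := Module.nontrivial_of_finrank_pos (R := ℝ) (by omega)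
  rw [InnerProductSpace.volume_ball, hd, ENNReal.ofReal_one, one_pow, one_mul,
    ← ENNReal.ofReal_natCast, ← ENNReal.ofReal_mul d.cast_nonneg]
  have hd0 : (0 : ℝ) < (d : ℝ) / 2 := by positivity
  have := Real.Gamma_pos_of_pos hd0
  rw [Real.Gamma_add_one hd0.ne', sphereArea, ← Real.rpow_natCast, Real.sqrt_eq_rpow,
    ← Real.rpow_mul Real.pi_pos.le]
  congr 1
  rw [one_div_mul_eq_div]
  field_simp

theorem lintegral_fun_norm {d : ℕ} (hd : Module.finrank ℝ E = d) (hd1 : 1 ≤ d)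
    {F : ℝ → ENNReal} (hF : Measurable F) :
    ∫⁻ w : E, F ‖w‖ =
      ENNReal.ofReal (sphereArea d) * ∫⁻ r in Ioi (0 : ℝ), ENNReal.ofReal (r ^ (d - 1)) * F r := by
  have : Nontrivial E := Module.nontrivial_of_finrank_pos (R := ℝ) (by omega)
  calc ∫⁻ w : E, F ‖w‖ = ∫⁻ w : ({(0)}ᶜ : Set E), F ‖w.1‖ ∂((volume : Measure E).comap (↑)) := by
        rw [lintegral_subtype_comap (measurableSet_singleton _).compl fun w => F ‖w‖,
          restrict_compl_singleton]
    _ = ∫⁻ x, F x.2 ∂(volume : Measure E).toSphere.prod (.volumeIoiPow (d - 1)) := by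
        rw [← hd, ← (volume : Measure E).measurePreserving_homeomorphUnitSphereProd.lintegral_comp
          (by fun_prop)]
        simp
    _ = (volume : Measure E).toSphere univ * ∫⁻ x : Ioi (0 : ℝ), F x ∂(.volumeIoiPow (d - 1)) := by
        rw [lintegral_prod _ (by fun_prop)]
        simp [mul_comm]
    _ = _ := by
        rw [Measure.toSphere_apply_univ, hd, finrank_mul_volume_ball hd hd1, Measure.volumeIoiPow,
          lintegral_withDensity_eq_lintegral_mul _ (by fun_prop) (by fun_prop)]
        congr 1
        exact lintegral_subtype_comap measurableSet_Ioi
          (fun r : ℝ => ENNReal.ofReal (r ^ (d - 1)) * F r)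

end Polar

/-! ### A substitution -/

/-- Here `a` and `b` are the lengths of the components of a vector along a `d`-dimensional subspace
and orthogonal to it. The new variable `r = s b / √(a² + b²)` is its distance to the subspace after
rescaling to length `s`, and the inverse map is `a = b √(s² - r²) / r`. -/
theorem lintegral_subst_hypot {b s : ℝ} (hb : 0 < b) (hs : 0 < s) {d : ℕ} (hd : 1 ≤ d)
    (G : ℝ → ENNReal) :
    ∫⁻ a in Ioi (0 : ℝ), ENNReal.ofReal (a ^ (d - 1)) * G (s * b / √(a ^ 2 + b ^ 2)) =
      ∫⁻ r in Ioo 0 s, ENNReal.ofReal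
        (b ^ d * (s ^ 2 * r⁻¹ ^ (d + 1) * (s ^ 2 - r ^ 2) ^ ((d : ℝ) / 2 - 1))) * G r := by
  set u : ℝ → ℝ := fun r => b * √(s ^ 2 - r ^ 2) / r with hu
  have hpos : ∀ r ∈ Ioo 0 s, 0 < s ^ 2 - r ^ 2 := fun r hr => by nlinarith [hr.1, hr.2]
  have hinv : ∀ r ∈ Ioo 0 s, s * b / √((u r) ^ 2 + b ^ 2) = r := by
    intro r hr
    have hr0 := hr.1
    have h1 : (u r) ^ 2 + b ^ 2 = (b * s / r) ^ 2 := by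
      simp only [hu]
      rw [div_pow, mul_pow, Real.sq_sqrt (hpos r hr).le]
      field_simp
      ring
    rw [h1, Real.sqrt_sq (by positivity)]
    field_simp
  have hderiv : ∀ r ∈ Ioo 0 s,
      HasDerivWithinAt u (-(b * s ^ 2 / (r ^ 2 * √(s ^ 2 - r ^ 2)))) (Ioo 0 s) r := by
    intro r hr
    have hr0 := hr.1
    have h0 := hpos r hr
    have h1 := Real.sqrt_pos.2 h0
    have h2 := ((((hasDerivAt_id r).pow 2).const_sub (s ^ 2)).sqrt (by simpa using h0.ne')
      |>.const_mul b).div (hasDerivAt_id r) hr0.ne'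
    refine (h2.congr_deriv ?_).hasDerivWithinAt
    simp only [Pi.pow_apply, id, Nat.cast_ofNat, pow_one, mul_one, Nat.add_one_sub_one]
    field_simp
    rw [Real.sq_sqrt h0.le]
    ring
  have himg : u '' Ioo 0 s = Ioi 0 := by
    refine Subset.antisymm ?_ fun a ha => ?_
    · rintro _ ⟨r, hr, rfl⟩
      have := hr.1
      have := Real.sqrt_pos.2 (hpos r hr)
      simp only [hu, mem_Ioi]
      positivity
    · have ha0 : (0 : ℝ) < a := ha
      have h1 : 0 < a ^ 2 + b ^ 2 := by positivity
      have h2 := Real.sqrt_pos.2 h1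
      refine ⟨s * b / √(a ^ 2 + b ^ 2), ⟨by positivity, ?_⟩, ?_⟩
      · rw [div_lt_iff₀ h2]
        gcongr
        exact Real.lt_sqrt_of_sq_lt (by nlinarith)
      · simp only [hu]
        have h3 : s ^ 2 - (s * b / √(a ^ 2 + b ^ 2)) ^ 2 = (s * a / √(a ^ 2 + b ^ 2)) ^ 2 := by
          rw [div_pow, div_pow, Real.sq_sqrt h1.le]
          field_simp
          ring
        rw [h3, Real.sqrt_sq (by positivity)]
        field_simp
  have hinj : InjOn u (Ioo 0 s) := by
    intro x hx y hy hxy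
    rw [← hinv x hx, ← hinv y hy, hxy]
  rw [← himg, lintegral_image_eq_lintegral_abs_deriv_mul measurableSet_Ioo hderiv hinj]
  refine setLIntegral_congr_fun measurableSet_Ioo fun r hr => ?_
  have hr0 := hr.1
  have h0 := hpos r hr
  have h1 := Real.sqrt_pos.2 h0
  rw [hinv r hr, ← mul_assoc, abs_neg, abs_of_nonneg (by positivity),
    ← ENNReal.ofReal_mul (by positivity)]
  congr 2
  have h2 : (s ^ 2 - r ^ 2) ^ ((d : ℝ) / 2 - 1) * √(s ^ 2 - r ^ 2) = √(s ^ 2 - r ^ 2) ^ (d - 1) := by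
    rw [← sq_rpow_half_sub_one h1 d hd, Real.sq_sqrt h0.le]
  obtain ⟨e, rfl⟩ : ∃ e, d = e + 1 := ⟨d - 1, by omega⟩
  simp only [add_tsub_cancel_right] at h2 ⊢
  simp only [hu]
  rw [div_pow, mul_pow, ← h2, inv_pow]
  field_simp
  ring

/-! ### The orthogonal group and projections -/

section Rotations

variable {Y : Type*} [NormedAddCommGroup Y] [InnerProductSpace ℝ Y] [FiniteDimensional ℝ Y]
  [CompleteSpace Y]

instance : (orthHaar Y).IsHaarMeasure := by
  unfold orthHaar
  infer_instance

instance : IsProbabilityMeasure (orthHaar Y) :=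
  ⟨by unfold orthHaar; exact Measure.haarMeasure_self⟩

theorem orth_inv_apply_self (γ : Orth Y) (x : Y) :
    ((γ⁻¹ : Orth Y) : Y →L[ℝ] Y) ((γ : Y →L[ℝ] Y) x) = x :=
  (Unitary.linearIsometryEquiv γ).symm_apply_apply x

theorem Gr.rotate_starProjection {j : ℕ} (γ : Orth Y) (ξ : Gr Y j) (x : Y) :
    (Gr.rotate γ ξ).1.starProjection x =
      (γ : Y →L[ℝ] Y) (ξ.1.starProjection (((γ⁻¹ : Orth Y) : Y →L[ℝ] Y) x)) :=
  Submodule.starProjection_map_apply (Unitary.linearIsometryEquiv γ) ξ.1 x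

theorem Gr.rotate_orthogonal_starProjection {j : ℕ} (γ : Orth Y) (ξ : Gr Y j) (x : Y) :
    (Gr.rotate γ ξ).1ᗮ.starProjection x =
      (γ : Y →L[ℝ] Y) (ξ.1ᗮ.starProjection (((γ⁻¹ : Orth Y) : Y →L[ℝ] Y) x)) := by
  have h : (γ : Y →L[ℝ] Y) (((γ⁻¹ : Orth Y) : Y →L[ℝ] Y) x) = x := by
    simpa using orth_inv_apply_self γ⁻¹ x
  rw [Submodule.starProjection_orthogonal', Submodule.starProjection_orthogonal']
  simp only [sub_apply, one_apply_eq_self, map_sub, h,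
    Gr.rotate_starProjection]

theorem continuous_rotate {j : ℕ} (ξ : Gr Y j) : Continuous fun γ : Orth Y => Gr.rotate γ ξ := by
  refine continuous_induced_rng.2 ?_
  have h : ((fun ξ : Gr Y j => (ξ.1.starProjection : Y →L[ℝ] Y)) ∘
      fun γ : Orth Y => Gr.rotate γ ξ) =
      fun γ : Orth Y => (γ : Y →L[ℝ] Y) * ξ.1.starProjection * ((γ⁻¹ : Orth Y) : Y →L[ℝ] Y) := by
    funext γ
    ext x
    exact Gr.rotate_starProjection γ ξ x
  rw [h]
  fun_prop

theorem continuous_norm_orthogonal_starProjection {j : ℕ} (v : Y) :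
    Continuous fun ξ : Gr Y j => ‖ξ.1ᗮ.starProjection v‖ := by
  simp_rw [Submodule.starProjection_orthogonal', sub_apply]
  have h : Continuous fun ξ : Gr Y j => (ξ.1.starProjection : Y →L[ℝ] Y) := continuous_induced_dom
  fun_prop

theorem exists_orth_apply_eq {v w : Y} (h : ‖v‖ = ‖w‖) : ∃ δ : Orth Y, (δ : Y →L[ℝ] Y) v = w :=
  ⟨Unitary.linearIsometryEquiv.symm ((Submodule.span ℝ {v - w})ᗮ.reflection),
    Submodule.reflection_sub h⟩

/-- The orthogonal group is transitive on spheres, through reflections, and Haar measure is left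
invariant, so the average depends only on the length of the vector. -/
theorem lintegral_orth_inv_eq {v w : Y} (h : ‖v‖ = ‖w‖) (G : Y → ENNReal) :
    ∫⁻ γ, G (((γ⁻¹ : Orth Y) : Y →L[ℝ] Y) w) ∂(orthHaar Y) =
      ∫⁻ γ, G (((γ⁻¹ : Orth Y) : Y →L[ℝ] Y) v) ∂(orthHaar Y) := by
  obtain ⟨δ, rfl⟩ := exists_orth_apply_eq h
  rw [← lintegral_mul_left_eq_self _ δ]
  refine lintegral_congr fun γ => ?_
  rw [mul_inv_rev]
  change G (((γ⁻¹ : Orth Y) : Y →L[ℝ] Y) (((δ⁻¹ : Orth Y) : Y →L[ℝ] Y) ((δ : Y →L[ℝ] Y) v))) = _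
  rw [orth_inv_apply_self]

variable [MeasurableSpace Y] [BorelSpace Y]

theorem lintegral_orth_average {ψ : Y → ENNReal} (hψ : Measurable ψ) :
    ∫⁻ w, ψ w = ∫⁻ w, ∫⁻ γ, ψ (((γ⁻¹ : Orth Y) : Y →L[ℝ] Y) w) ∂(orthHaar Y) := by
  have hc : Continuous fun p : Y × Orth Y => ((p.2⁻¹ : Orth Y) : Y →L[ℝ] Y) p.1 := by fun_prop
  rw [lintegral_lintegral_swap (f := fun w (γ : Orth Y) => ψ (((γ⁻¹ : Orth Y) : Y →L[ℝ] Y) w))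
    (hψ.comp hc.measurable).aemeasurable]
  have h : ∀ γ : Orth Y, ∫⁻ w, ψ (((γ⁻¹ : Orth Y) : Y →L[ℝ] Y) w) = ∫⁻ w, ψ w := fun γ =>
    (Unitary.linearIsometryEquiv γ⁻¹).measurePreserving.lintegral_comp hψ
  simp_rw [h]
  simp

/-- Integration of a function of the two components of `w = a + b` in `K ⊕ Kᗮ`. -/
theorem lintegral_orthogonal_decomp (K : Submodule ℝ Y) {Φ : ℝ → ℝ → ENNReal}
    (hΦ : Measurable (Function.uncurry Φ)) :
    ∫⁻ w : Y, Φ ‖w‖ ‖Kᗮ.starProjection w‖ =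
      ∫⁻ b : Kᗮ, ∫⁻ a : K, Φ (√(‖a‖ ^ 2 + ‖b‖ ^ 2)) ‖b‖ := by
  have h1 := (WithLp.volume_preserving_ofLp K Kᗮ).comp
    K.orthogonalDecomposition.measurePreserving
  have hm : Measurable fun p : K × Kᗮ => Φ (√(‖p.1‖ ^ 2 + ‖p.2‖ ^ 2)) ‖p.2‖ :=
    hΦ.comp (by fun_prop : Measurable fun p : K × Kᗮ => (√(‖p.1‖ ^ 2 + ‖p.2‖ ^ 2), ‖p.2‖))
  have h2 := h1.lintegral_comp hm
  rw [Measure.volume_eq_prod, lintegral_prod_symm _ hm.aemeasurable] at h2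
  rw [← h2]
  refine lintegral_congr fun w => ?_
  have hw : ‖w‖ = √(‖K.orthogonalProjectionOnto w‖ ^ 2 + ‖Kᗮ.orthogonalProjectionOnto w‖ ^ 2) := by
    rw [← K.orthogonalDecomposition.norm_map w, WithLp.prod_norm_eq_of_L2]
    simp
  rw [hw]
  simp [Function.comp]

end Rotations

/-! ### The distribution of the distance from a fixed vector to a random subspace -/

section Law

variable {Y : Type*} [NormedAddCommGroup Y] [InnerProductSpace ℝ Y] [FiniteDimensional ℝ Y]
  [CompleteSpace Y] [MeasurableSpace Y] [BorelSpace Y]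

/-- The density of the distance `r` between a vector of length `s` in an `N`-dimensional space and
a random `j`-dimensional subspace. -/
def distDensity (N j : ℕ) (s r : ℝ) : ℝ :=
  sphereArea j * sphereArea (N - j) / sphereArea N *
    (s ^ 2 * r⁻¹ ^ (j + 1) * (s ^ 2 - r ^ 2) ^ ((j : ℝ) / 2 - 1) * (r / s) ^ N)

theorem distDensity_nonneg {N j : ℕ} {s r : ℝ} (hj : 1 ≤ j) (hjN : j < N) (hr : r ∈ Ioo 0 s) :
    0 ≤ distDensity N j s r := by
  have h1 := sphereArea_pos hj
  have h2 := sphereArea_pos (show 1 ≤ N - j by omega)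
  have h3 := sphereArea_pos (show 1 ≤ N by omega)
  have h4 : 0 ≤ s ^ 2 - r ^ 2 := by nlinarith [hr.1, hr.2]
  have := hr.1
  have := hr.1.trans hr.2
  rw [distDensity]
  positivity

theorem measurable_distDensity (N j : ℕ) (s : ℝ) : Measurable (distDensity N j s) := by
  unfold distDensity
  fun_prop

theorem lintegral_pow_Ioo {c : ℝ} (hc : 0 < c) {N : ℕ} (hN : 1 ≤ N) :
    ∫⁻ β in Ioo 0 c, ENNReal.ofReal (β ^ (N - 1)) = ENNReal.ofReal (c ^ N / N) := by
  rw [setLIntegral_congr Ioo_ae_eq_Ioc, ← ofReal_integral_eq_lintegral_ofReal,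
    ← intervalIntegral.integral_of_le hc.le, integral_pow]
  · simp [Nat.sub_add_cancel hN, show N ≠ 0 by omega, hN]
  · exact (intervalIntegrable_iff_integrableOn_Ioc_of_le hc.le).1
      ((continuous_pow _).intervalIntegrable _ _)
  · filter_upwards [ae_restrict_mem measurableSet_Ioc] with x hx
    exact pow_nonneg hx.1.le _

/-- The average of a truncated homogeneous function of the distance to a fixed subspace. -/
theorem lintegral_truncated_dist {N j : ℕ} (hN : Module.finrank ℝ Y = N) (hj : 1 ≤ j) (hjN : j < N)
    (ξ : Gr Y j) {s : ℝ} (hs : 0 < s) {g : ℝ → ENNReal} (hg : Measurable g) :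
    (N : ENNReal) * ∫⁻ w : Y, (if ‖w‖ < 1 then g (s * ‖ξ.1ᗮ.starProjection w‖ / ‖w‖) else 0) =
      ENNReal.ofReal (sphereArea N) *
        ∫⁻ r in Ioo 0 s, ENNReal.ofReal (distDensity N j s r) * g r := by
  have hj' : Module.finrank ℝ ξ.1 = j := ξ.2
  have hNj' : Module.finrank ℝ ξ.1ᗮ = N - j := by
    have := ξ.1.finrank_add_finrank_orthogonal
    omega
  have hNj1 : 1 ≤ N - j := by omega
  have hσj := sphereArea_pos hj
  have hσNj := sphereArea_pos hNj1
  have hσN := sphereArea_pos (show 1 ≤ N by omega)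
  set w : ℝ → ℝ := fun r => s ^ 2 * r⁻¹ ^ (j + 1) * (s ^ 2 - r ^ 2) ^ ((j : ℝ) / 2 - 1) with hw
  have hw0 : ∀ r ∈ Ioo 0 s, 0 ≤ w r := by
    intro r hr
    have h4 : 0 ≤ s ^ 2 - r ^ 2 := by nlinarith [hr.1, hr.2]
    have := hr.1
    positivity
  have hwm : Measurable w := by simp only [hw]; fun_prop
  set Φ : ℝ → ℝ → ENNReal := fun ρ q => if ρ < 1 then g (s * q / ρ) else 0 with hΦ
  have hΦm : Measurable (Function.uncurry Φ) :=
    Measurable.ite (measurableSet_lt measurable_fst measurable_const)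
      (hg.comp (by fun_prop)) measurable_const
  set H : ℝ → ENNReal := fun β => ∫⁻ a in Ioi (0 : ℝ),
    ENNReal.ofReal (a ^ (j - 1)) * Φ (√(a ^ 2 + β ^ 2)) β with hH
  have hHm : Measurable H := by
    refine Measurable.lintegral_prod_right (f := fun β a : ℝ => ENNReal.ofReal (a ^ (j - 1)) *
      Φ (√(a ^ 2 + β ^ 2)) β) ?_
    refine Measurable.mul (by fun_prop) ?_
    exact hΦm.comp (by fun_prop : Measurable fun p : ℝ × ℝ => (√(p.2 ^ 2 + p.1 ^ 2), p.1))
  -- In the variable `r` the truncation `‖w‖ < 1` reads `β < r / s`, and the powers of `β` combine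
  -- to `β^{N-1}`. After the order of integration is exchanged, the integral over `β` gives the
  -- factor `(r / s)^N / N` of the density.
  have hHeq : ∀ β ∈ Ioi (0 : ℝ), ENNReal.ofReal (β ^ (N - j - 1)) * H β =
      ∫⁻ r in Ioo 0 s, ENNReal.ofReal (w r) * g r *
        (Ioo 0 (r / s)).indicator (fun β => ENNReal.ofReal (β ^ (N - 1))) β := by
    intro β hβ
    have hβ0 : (0 : ℝ) < β := hβ
    have h1 : H β = ∫⁻ r in Ioo 0 s, ENNReal.ofReal (β ^ j * w r) *
        (if s * β < r then g r else 0) := by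
      rw [hH, ← lintegral_subst_hypot hβ0 hs hj (fun r => if s * β < r then g r else 0)]
      refine lintegral_congr fun a => ?_
      have h2 : 0 < √(a ^ 2 + β ^ 2) := Real.sqrt_pos.2 (by positivity)
      simp only [hΦ]
      have h3 : s * β < s * β / √(a ^ 2 + β ^ 2) ↔ √(a ^ 2 + β ^ 2) < 1 := by
        rw [lt_div_iff₀ h2, mul_lt_iff_lt_one_right (by positivity)]
      simp only [h3]
    rw [h1, ← lintegral_const_mul' _ _ ENNReal.ofReal_ne_top]
    refine setLIntegral_congr_fun measurableSet_Ioo fun r hr => ?_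
    have h4 : β ∈ Ioo 0 (r / s) ↔ s * β < r := by
      rw [mem_Ioo, lt_div_iff₀ hs, mul_comm β]
      exact and_iff_right hβ0
    by_cases hc : s * β < r
    · rw [indicator_of_mem (h4.2 hc), if_pos hc, ENNReal.ofReal_mul (by positivity), ← mul_assoc,
        ← mul_assoc, ← ENNReal.ofReal_mul (by positivity), ← pow_add,
        show N - j - 1 + j = N - 1 by omega]
      ring
    · rw [indicator_of_notMem (fun h => hc (h4.1 h)), if_neg hc]
      simp
  calc (N : ENNReal) * ∫⁻ w : Y, (if ‖w‖ < 1 then g (s * ‖ξ.1ᗮ.starProjection w‖ / ‖w‖) else 0)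
      = N * ∫⁻ b : ξ.1ᗮ, ∫⁻ a : ξ.1, Φ (√(‖a‖ ^ 2 + ‖b‖ ^ 2)) ‖b‖ := by
        rw [← lintegral_orthogonal_decomp ξ.1 hΦm]
    _ = N * ∫⁻ b : ξ.1ᗮ, ENNReal.ofReal (sphereArea j) * H ‖b‖ := by
        congr 1
        refine lintegral_congr fun b => ?_
        exact lintegral_fun_norm hj' hj (F := fun a => Φ (√(a ^ 2 + ‖b‖ ^ 2)) ‖b‖)
          (hΦm.comp (by fun_prop : Measurable fun a : ℝ => (√(a ^ 2 + ‖b‖ ^ 2), ‖b‖)))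
    _ = N * (ENNReal.ofReal (sphereArea j) * (ENNReal.ofReal (sphereArea (N - j)) *
          ∫⁻ β in Ioi (0 : ℝ), ENNReal.ofReal (β ^ (N - j - 1)) * H β)) := by
        rw [lintegral_const_mul' _ _ ENNReal.ofReal_ne_top, lintegral_fun_norm hNj' hNj1 hHm]
    _ = N * (ENNReal.ofReal (sphereArea j) * (ENNReal.ofReal (sphereArea (N - j)) *
          ∫⁻ r in Ioo 0 s, ENNReal.ofReal (w r) * g r * ENNReal.ofReal ((r / s) ^ N / N))) := by
        rw [setLIntegral_congr_fun measurableSet_Ioi hHeq, lintegral_lintegral_swap]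
        · congr 3
          refine setLIntegral_congr_fun measurableSet_Ioo fun r hr => ?_
          have hrs : 0 < r / s := div_pos hr.1 hs
          rw [lintegral_const_mul _ ((by fun_prop : Measurable fun β : ℝ =>
            ENNReal.ofReal (β ^ (N - 1))).indicator measurableSet_Ioo),
            setLIntegral_indicator measurableSet_Ioo, inter_eq_left.2 Ioo_subset_Ioi_self,
            lintegral_pow_Ioo hrs (by omega)]
        · refine Measurable.aemeasurable (Measurable.mul (by fun_prop) ?_)
          have : (fun p : ℝ × ℝ => (Ioo 0 (p.2 / s)).indicator
              (fun β => ENNReal.ofReal (β ^ (N - 1))) p.1) =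
              {p : ℝ × ℝ | 0 < p.1 ∧ p.1 < p.2 / s}.indicator
                fun p => ENNReal.ofReal (p.1 ^ (N - 1)) := by
            ext p
            simp [indicator]
          rw [this]
          refine Measurable.indicator (by fun_prop) ?_
          exact (measurableSet_lt measurable_const measurable_fst).inter
            (measurableSet_lt measurable_fst (by fun_prop))
    _ = _ := by
        simp_rw [← lintegral_const_mul' _ _ ENNReal.ofReal_ne_top]
        rw [← lintegral_const_mul' _ _ (ENNReal.natCast_ne_top N)]
        refine setLIntegral_congr_fun measurableSet_Ioo fun r hr => ?_
        have h5 := hw0 r hr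
        have hrs : 0 < r / s := div_pos hr.1 hs
        have hN0 : (0 : ℝ) < N := by exact_mod_cast (show 0 < N by omega)
        calc (N : ENNReal) * (ENNReal.ofReal (sphereArea j) * (ENNReal.ofReal (sphereArea (N - j)) *
              (ENNReal.ofReal (w r) * g r * ENNReal.ofReal ((r / s) ^ N / N))))
            = ENNReal.ofReal N * ENNReal.ofReal (sphereArea j) * ENNReal.ofReal (sphereArea (N - j)) *
              ENNReal.ofReal (w r) * ENNReal.ofReal ((r / s) ^ N / N) * g r := by
              rw [ENNReal.ofReal_natCast]; ring
          _ = ENNReal.ofReal (sphereArea N) * ENNReal.ofReal (distDensity N j s r) * g r := by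
              rw [← ENNReal.ofReal_mul (by positivity), ← ENNReal.ofReal_mul (by positivity),
                ← ENNReal.ofReal_mul (by positivity), ← ENNReal.ofReal_mul (by positivity),
                ← ENNReal.ofReal_mul (by positivity)]
              congr 2
              rw [distDensity]
              simp only [hw]
              field_simp
          _ = _ := by rw [mul_assoc]

/-- The function `g(s ‖P w‖ / ‖w‖)`, with `P` the projection onto `ξᗮ`, is integrated over the unit
ball in two ways. Averaging over rotations gives the required mean times the volume of the ball;
splitting `w` along `ξ` and `ξᗮ` gives the density. The total area of the sphere cancels. -/
theorem lintegral_orth_dist {N j : ℕ} (hN : Module.finrank ℝ Y = N) (hj : 1 ≤ j) (hjN : j < N)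
    (ξ : Gr Y j) {v : Y} (hv : v ≠ 0) {g : ℝ → ENNReal} (hg : Measurable g) :
    ∫⁻ γ, g ‖ξ.1ᗮ.starProjection (((γ⁻¹ : Orth Y) : Y →L[ℝ] Y) v)‖ ∂(orthHaar Y) =
      ∫⁻ r in Ioo 0 ‖v‖, ENNReal.ofReal (distDensity N j ‖v‖ r) * g r := by
  have hs : 0 < ‖v‖ := norm_pos_iff.2 hv
  have hσN := sphereArea_pos (show 1 ≤ N by omega)
  have : Nontrivial Y := ⟨v, 0, hv⟩
  set M := ∫⁻ γ, g ‖ξ.1ᗮ.starProjection (((γ⁻¹ : Orth Y) : Y →L[ℝ] Y) v)‖ ∂(orthHaar Y) with hM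
  have h1 := lintegral_truncated_dist hN hj hjN ξ hs hg
  have hψm : Measurable fun w : Y =>
      if ‖w‖ < 1 then g (‖v‖ * ‖ξ.1ᗮ.starProjection w‖ / ‖w‖) else 0 :=
    Measurable.ite (measurableSet_lt measurable_norm measurable_const) (hg.comp (by fun_prop))
      measurable_const
  have h2 : ∫⁻ w : Y, (if ‖w‖ < 1 then g (‖v‖ * ‖ξ.1ᗮ.starProjection w‖ / ‖w‖) else 0) =
      M * volume (Metric.ball (0 : Y) 1) := by
    rw [lintegral_orth_average hψm, ← setLIntegral_const, ← lintegral_indicator measurableSet_ball]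
    refine lintegral_congr_ae ?_
    filter_upwards [compl_mem_ae_iff.2 (measure_singleton (0 : Y))] with w hw
    have hw0 : w ≠ 0 := hw
    have hwn : 0 < ‖w‖ := norm_pos_iff.2 hw0
    have hn : ∀ γ : Orth Y, ‖((γ⁻¹ : Orth Y) : Y →L[ℝ] Y) w‖ = ‖w‖ := fun γ =>
      Unitary.norm_map γ⁻¹ w
    simp_rw [hn]
    by_cases hw1 : ‖w‖ < 1
    · rw [indicator_of_mem (by simpa using hw1)]
      simp_rw [if_pos hw1]
      -- The integrand is homogeneous of degree zero in `w`, which may thus be rescaled to the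
      -- length of `v`.
      rw [hM, ← lintegral_orth_inv_eq (v := v) (w := (‖v‖ / ‖w‖) • w)
        (by rw [norm_smul, Real.norm_of_nonneg (by positivity), div_mul_cancel₀ _ hwn.ne'])
        (fun x => g ‖ξ.1ᗮ.starProjection x‖)]
      refine lintegral_congr fun γ => ?_
      rw [map_smul, map_smul, norm_smul, Real.norm_of_nonneg (by positivity), mul_div_right_comm]
    · rw [indicator_of_notMem (by simpa using hw1)]
      simp [hw1]
  rw [h2, mul_left_comm, finrank_mul_volume_ball hN (by omega), mul_comm] at h1
  exact (ENNReal.mul_right_inj (by simpa using hσN) ENNReal.ofReal_ne_top).1 h1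

/-- The distribution of the distance between a vector of length `s` in an `N`-dimensional space and
a random `j`-dimensional subspace. -/
def distLaw (N j : ℕ) (s : ℝ) : Measure ℝ :=
  (volume.restrict (Ioo 0 s)).withDensity fun r => ENNReal.ofReal (distDensity N j s r)

theorem nonempty_Gr {N j : ℕ} (hN : Module.finrank ℝ Y = N) (hjN : j ≤ N) : Nonempty (Gr Y j) := by
  subst hN
  have h := (Module.finBasis ℝ Y).linearIndependent.comp _ (Fin.castLE_injective hjN)
  exact ⟨⟨_, (finrank_span_eq_card h).trans (Fintype.card_fin j)⟩⟩

theorem map_grMeasure {N j : ℕ} (hN : Module.finrank ℝ Y = N) (hj : 1 ≤ j) (hjN : j < N) {v : Y}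
    (hv : v ≠ 0) :
    (grMeasure Y j).map (fun ξ : Gr Y j => ‖ξ.1ᗮ.starProjection v‖) = distLaw N j ‖v‖ := by
  have hne := nonempty_Gr hN hjN.le
  have hm := (continuous_norm_orthogonal_starProjection (j := j) v).measurable
  refine Measure.ext_of_lintegral _ fun g hg => ?_
  rw [lintegral_map hg hm, grMeasure, dif_pos hne]
  refine (lintegral_map (hg.comp hm) (continuous_rotate _).measurable).trans ?_
  rw [distLaw, lintegral_withDensity_eq_lintegral_mul _
    (measurable_distDensity N j _).ennreal_ofReal hg]
  refine Eq.trans (lintegral_congr fun γ => ?_) (lintegral_orth_dist hN hj hjN hne.some hv hg)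
  simp only [Function.comp_apply]
  rw [Gr.rotate_orthogonal_starProjection, Unitary.norm_map]

end Law

/-! ### Radial functions on the affine Grassmannian -/

section Affine

variable {X : Type*} [NormedAddCommGroup X] [InnerProductSpace ℝ X] [FiniteDimensional ℝ X]
  [CompleteSpace X]

theorem AffGr.foot_rotate_through {j : ℕ} (ξ : Gr X j) (γ : Orth X) (u : (ξ.1ᗮ : Submodule ℝ X)) :
    (AffGr.rotate γ (AffGr.through ξ (u : X))).foot = (γ : X →L[ℝ] X) u := by
  have h1 : ξ.1ᗮ.starProjection (u : X) = u := Submodule.starProjection_eq_self_iff.2 u.2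
  have h2 := Gr.rotate_orthogonal_starProjection γ ξ
    ((γ : X →L[ℝ] X) (ξ.1ᗮ.starProjection (u : X)))
  rw [orth_inv_apply_self, h1, h1] at h2
  refine Eq.trans ?_ h2
  change (Gr.rotate γ ξ).1ᗮ.starProjection ((γ : X →L[ℝ] X) (ξ.1ᗮ.starProjection (u : X))) = _
  rw [h1]

theorem AffGr.dist0_rotate_through {j : ℕ} (ξ : Gr X j) (γ : Orth X)
    (u : (ξ.1ᗮ : Submodule ℝ X)) : (AffGr.rotate γ (AffGr.through ξ (u : X))).dist0 = ‖u‖ := by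
  rw [AffGr.dist0, AffGr.foot_rotate_through, Unitary.norm_map, Submodule.coe_norm]

theorem continuous_rotate_through {j : ℕ} (ξ : Gr X j) :
    Continuous fun p : Orth X × (ξ.1ᗮ : Submodule ℝ X) =>
      AffGr.rotate p.1 (AffGr.through ξ (p.2 : X)) := by
  refine continuous_induced_rng.2 (Continuous.prodMk ?_ ?_)
  · have h : Continuous fun ξ : Gr X j => (ξ.1.starProjection : X →L[ℝ] X) :=
      continuous_induced_dom
    exact h.comp ((continuous_rotate ξ).comp continuous_fst)
  · simp_rw [AffGr.foot_rotate_through]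
    fun_prop

theorem continuous_dist0 {j : ℕ} : Continuous (AffGr.dist0 : AffGr X j → ℝ) :=
  have h : Continuous fun τ : AffGr X j => ((τ.dir.starProjection : X →L[ℝ] X), τ.foot) :=
    continuous_induced_dom
  (continuous_snd.comp h).norm

variable [MeasurableSpace X] [BorelSpace X]

theorem affGrMeasure_eq {N j : ℕ} (hN : Module.finrank ℝ X = N) (hj : j ≤ N) :
    ∃ ξ : Gr X j, affGrMeasure X j =
      ((orthHaar X).prod (volume : Measure (ξ.1ᗮ : Submodule ℝ X))).map
        (fun p => AffGr.rotate p.1 (AffGr.through ξ (p.2 : X))) :=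
  have h : Nonempty (Gr X j) := nonempty_Gr hN hj
  ⟨h.some, dif_pos h⟩

theorem finrank_orthogonal_of_Gr {N j : ℕ} (hN : Module.finrank ℝ X = N) (ξ : Gr X j) :
    Module.finrank ℝ (ξ.1ᗮ : Submodule ℝ X) = N - j := by
  have h1 : Module.finrank ℝ ξ.1 = j := ξ.2
  have := ξ.1.finrank_add_finrank_orthogonal
  omega

/-- By polar coordinates in `ξᗮ`, of dimension `N - j ≥ 1`, null sets of radii correspond to null
sets of planes. This carries statements for almost all `s > 0` over to almost all planes. -/
theorem quasiMeasurePreserving_dist0 {N j : ℕ} (hN : Module.finrank ℝ X = N) (hj : j < N) :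
    Measure.QuasiMeasurePreserving (AffGr.dist0 : AffGr X j → ℝ) (affGrMeasure X j)
      (volume.restrict (Ioi 0)) := by
  have hm := (continuous_dist0 (X := X) (j := j)).measurable
  refine ⟨hm, Measure.AbsolutelyContinuous.mk fun s hs h0 => ?_⟩
  obtain ⟨ξ, hξ⟩ := affGrMeasure_eq hN hj.le
  have hE := finrank_orthogonal_of_Gr hN ξ
  rw [Measure.map_apply hm hs, hξ, Measure.map_apply (continuous_rotate_through ξ).measurable (hm hs)]
  have hset : (fun p : Orth X × (ξ.1ᗮ : Submodule ℝ X) =>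
      AffGr.rotate p.1 (AffGr.through ξ (p.2 : X))) ⁻¹' (AffGr.dist0 ⁻¹' s) =
      univ ×ˢ {u | ‖u‖ ∈ s} := by
    ext p
    simp [AffGr.dist0_rotate_through]
  rw [hset, Measure.prod_prod, measure_univ, one_mul]
  have h1 := lintegral_fun_norm hE (by omega) (measurable_one.indicator hs)
  have h2 : ∫⁻ r in Ioi (0 : ℝ), ENNReal.ofReal (r ^ (N - j - 1)) *
      s.indicator (1 : ℝ → ENNReal) r = 0 := by
    rw [lintegral_eq_zero_iff (by have := measurable_one.indicator (β := ENNReal) hs; fun_prop)]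
    filter_upwards [compl_mem_ae_iff.2 h0] with r hr
    simp [indicator_of_notMem (show r ∉ s from hr)]
  rw [h2, mul_zero] at h1
  exact (lintegral_indicator_one (measurable_norm hs)).symm.trans h1

theorem IntegrableOn.comp_of_map {α β : Type*} [MeasurableSpace α] [MeasurableSpace β]
    {μ : Measure α} {Φ : α → β} (hΦ : Measurable Φ) {F : Type*} [NormedAddCommGroup F] {f : β → F}
    {s : Set β} (hs : MeasurableSet s) (hf : IntegrableOn f s (μ.map Φ)) :
    IntegrableOn (f ∘ Φ) (Φ ⁻¹' s) μ := by
  rw [IntegrableOn, Measure.restrict_map hΦ hs] at hf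
  exact hf.comp_measurable hΦ

/-- The orthogonal group is compact, so its product with a closed ball of `ξᗮ` is compact; the
probability factor drops out and polar coordinates in dimension `n - j` produce the weight. -/
theorem radialIntegrable_near {n j : ℕ} (hn : Module.finrank ℝ X = n) (hj : j < n)
    {f : AffGr X j → ℂ} {f₀ : ℝ → ℂ} (hrad : ∀ τ, f τ = f₀ τ.dist0)
    (hloc : LocallyIntegrable f (affGrMeasure X j)) {S : ℝ} :
    IntegrableOn (fun r => r ^ (n - j - 1) • f₀ r) (Ioc 0 S) := by
  obtain ⟨ξ, hξ⟩ := affGrMeasure_eq hn hj.le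
  have hE := finrank_orthogonal_of_Gr hn ξ
  have hΦ := continuous_rotate_through ξ
  have : Nontrivial (ξ.1ᗮ : Submodule ℝ X) := Module.nontrivial_of_finrank_pos (R := ℝ) (by omega)
  have h1 : LocallyIntegrable (fun p : Orth X × (ξ.1ᗮ : Submodule ℝ X) => f₀ ‖p.2‖)
      ((orthHaar X).prod volume) := by
    intro p
    obtain ⟨U, hU, hfU⟩ := hloc (AffGr.rotate p.1 (AffGr.through ξ (p.2 : X)))
    obtain ⟨V, hVU, hV, hpV⟩ := mem_nhds_iff.1 hU
    have h2 := hfU.mono_set hVU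
    rw [hξ] at h2
    refine ⟨_, (hV.preimage hΦ).mem_nhds hpV, ?_⟩
    refine (IntegrableOn.comp_of_map hΦ.measurable hV.measurableSet h2).congr_fun
      (fun q _ => ?_) (hV.preimage hΦ).measurableSet
    simp only [Function.comp_apply]
    rw [hrad, AffGr.dist0_rotate_through]
  -- Radius `S + 1` keeps the endpoint `r = S` inside the open ball used below.
  have h3 := h1.integrableOn_isCompact
    (isCompact_univ.prod (isCompact_closedBall (0 : (ξ.1ᗮ : Submodule ℝ X)) (S + 1)))
  rw [IntegrableOn, ← Measure.prod_restrict, Measure.restrict_univ] at h3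
  have h4 : IntegrableOn (fun u : (ξ.1ᗮ : Submodule ℝ X) => f₀ ‖u‖) (Metric.ball 0 (S + 1)) :=
    IntegrableOn.mono_set ((Integrable.comp_snd_iff (IsProbabilityMeasure.ne_zero _)).1 h3) Metric.ball_subset_closedBall
  rw [integrableOn_fun_norm_addHaar, hE] at h4
  exact h4.mono_set fun r hr => ⟨hr.1, hr.2.trans_lt (by linarith)⟩

/-- Polar coordinates multiply `r^{k+j-n}` by `r^{n-j-1}`, which gives `r^{k-1}` beyond the given
`a`. A smaller threshold `b` costs only the interval `(b, a]`, covered by local integrability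
because there the two weights are comparable. -/
theorem radialIntegrable_of_affGr {n j k : ℕ} (hn : Module.finrank ℝ X = n) (hk : 1 ≤ k)
    (hjk : j + k < n) {f : AffGr X j → ℂ} {f₀ : ℝ → ℂ} (hrad : ∀ τ, f τ = f₀ τ.dist0)
    (hloc : LocallyIntegrable f (affGrMeasure X j))
    (hex : ∃ a : ℝ, 0 < a ∧ IntegrableOn (fun τ => ‖f τ‖ * τ.dist0 ^ ((k : ℤ) + j - n))
      {τ | a < τ.dist0} (affGrMeasure X j)) : RadialIntegrable n j k f₀ := by
  have hnear := fun S : ℝ => radialIntegrable_near hn (by omega) hrad hloc (S := S)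
  have hm : AEStronglyMeasurable f₀ (volume.restrict (Ioi 0)) := by
    have h1 : (Ioi (0 : ℝ)) = ⋃ N : ℕ, Ioc (0 : ℝ) N := by
      ext r
      simp only [mem_Ioi, mem_iUnion, mem_Ioc, exists_and_left, iff_self_and]
      exact fun _ => exists_nat_ge r
    rw [h1, aestronglyMeasurable_iUnion_iff]
    exact fun N => aestronglyMeasurable_of_smul measurableSet_Ioc (by fun_prop)
      (fun r hr => (pow_pos hr.1 (n - j - 1)).ne') (hnear N).aestronglyMeasurable
  refine ⟨hm, fun S _ => hnear S, fun b hb => ?_⟩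
  obtain ⟨a, ha, hfa⟩ := hex
  have hfar : IntegrableOn (fun r => r ^ (k - 1) • f₀ r) (Ioi a) := by
    obtain ⟨ξ, hξ⟩ := affGrMeasure_eq hn (show j ≤ n by omega)
    have hE := finrank_orthogonal_of_Gr hn ξ
    have hΦ := continuous_rotate_through ξ
    have : Nontrivial (ξ.1ᗮ : Submodule ℝ X) := Module.nontrivial_of_finrank_pos (R := ℝ) (by omega)
    have hms : MeasurableSet {τ : AffGr X j | a < τ.dist0} :=
      measurableSet_lt measurable_const continuous_dist0.measurable
    rw [hξ] at hfa
    have h1 := IntegrableOn.comp_of_map hΦ.measurable hms hfa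
    have hset : (fun p : Orth X × (ξ.1ᗮ : Submodule ℝ X) =>
        AffGr.rotate p.1 (AffGr.through ξ (p.2 : X))) ⁻¹' {τ | a < τ.dist0} =
        univ ×ˢ {u | a < ‖u‖} := by
      ext p
      simp [AffGr.dist0_rotate_through]
    have hcomp : (fun τ : AffGr X j => ‖f τ‖ * τ.dist0 ^ ((k : ℤ) + j - n)) ∘
        (fun p : Orth X × (ξ.1ᗮ : Submodule ℝ X) =>
          AffGr.rotate p.1 (AffGr.through ξ (p.2 : X))) =
        fun p => ‖f₀ ‖p.2‖‖ * ‖p.2‖ ^ ((k : ℤ) + j - n) := by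
      funext p
      simp only [Function.comp_apply]
      rw [hrad, AffGr.dist0_rotate_through]
    rw [hset, hcomp, IntegrableOn, ← Measure.prod_restrict, Measure.restrict_univ] at h1
    have h2 : IntegrableOn (fun u : (ξ.1ᗮ : Submodule ℝ X) => ‖f₀ ‖u‖‖ * ‖u‖ ^ ((k : ℤ) + j - n))
        {u | a < ‖u‖} := (Integrable.comp_snd_iff (IsProbabilityMeasure.ne_zero _)).1 h1
    rw [← integrable_indicator_iff (measurableSet_lt measurable_const measurable_norm)] at h2
    have h3 : Integrable (fun u : (ξ.1ᗮ : Submodule ℝ X) =>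
        (Ioi a).indicator (fun r => ‖f₀ r‖ * r ^ ((k : ℤ) + j - n)) ‖u‖) := h2
    rw [integrable_fun_norm_addHaar, hE] at h3
    have h4 := h3.mono_set (Ioi_subset_Ioi ha.le)
    refine Integrable.mono' h4 ((by fun_prop : Measurable fun r : ℝ =>
      r ^ (k - 1)).aestronglyMeasurable.smul
        (hm.mono_measure (Measure.restrict_mono (Ioi_subset_Ioi ha.le) le_rfl))) ?_
    filter_upwards [ae_restrict_mem measurableSet_Ioi] with r hr
    have hr0 : 0 < r := ha.trans hr
    rw [indicator_of_mem hr, norm_smul, Real.norm_of_nonneg (by positivity), smul_eq_mul,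
      mul_left_comm, mul_comm]
    refine (congrArg _ ?_).le
    rw [← zpow_natCast, ← zpow_natCast, ← zpow_add₀ hr0.ne']
    congr 1
    omega
  rcases le_or_gt a b with hab | hba
  · exact hfar.mono_set (Ioi_subset_Ioi hab)
  · rw [← Ioc_union_Ioi_eq_Ioi hba.le]
    refine IntegrableOn.union ?_ hfar
    have h1 := (hnear a).mono_set (Ioc_subset_Ioc_left hb.le)
    have h2 := Integrable.bdd_smul (φ := fun r : ℝ => (r ^ (n - j - k))⁻¹) h1
      (b ^ (n - j - k))⁻¹ (Measurable.aestronglyMeasurable (by fun_prop)) (by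
        filter_upwards [ae_restrict_mem measurableSet_Ioc] with r hr
        have hr0 : 0 < r := hb.trans hr.1
        rw [Real.norm_of_nonneg (by positivity)]
        gcongr
        exact hr.1.le)
    refine IntegrableOn.congr_fun h2 (fun r hr => ?_) measurableSet_Ioc
    have hr0 : 0 < r := hb.trans hr.1
    simp only [Pi.smul_apply']
    rw [smul_smul]
    congr 1
    rw [inv_mul_eq_iff_eq_mul₀ (by positivity), ← pow_add]
    congr 1
    omega

end Affine

/-! ### Integration over planes at a given distance from the origin -/

section Plane

variable {r : ℝ}

theorem sqrt_sq_sub_sq_pos (hr : 0 ≤ r) {ρ : ℝ} (hρ : ρ ∈ Ioi r) : 0 < √(ρ ^ 2 - r ^ 2) :=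
  Real.sqrt_pos.2 (by nlinarith [show r < ρ from hρ])

theorem sqrt_sqrt_sq_add_sq (hr : 0 ≤ r) {ρ : ℝ} (hρ : ρ ∈ Ioi r) :
    √(√(ρ ^ 2 - r ^ 2) ^ 2 + r ^ 2) = ρ := by
  have hρ0 : 0 ≤ ρ := hr.trans (le_of_lt hρ)
  rw [Real.sq_sqrt (by nlinarith [show r < ρ from hρ]), sub_add_cancel, Real.sqrt_sq hρ0]

theorem hasDerivWithinAt_sqrt_sq_sub_sq (hr : 0 ≤ r) {ρ : ℝ} (hρ : ρ ∈ Ioi r) :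
    HasDerivWithinAt (fun ρ => √(ρ ^ 2 - r ^ 2)) (ρ / √(ρ ^ 2 - r ^ 2)) (Ioi r) ρ := by
  have h1 := sqrt_sq_sub_sq_pos hr hρ
  have h2 := (((hasDerivAt_id ρ).pow 2).sub_const (r ^ 2)).sqrt (by
    simpa using (Real.sqrt_pos.1 h1).ne')
  refine (h2.congr_deriv ?_).hasDerivWithinAt
  simp only [Pi.pow_apply, id, Nat.cast_ofNat, pow_one, mul_one, Nat.add_one_sub_one]
  field_simp

theorem injOn_sqrt_sq_sub_sq (hr : 0 ≤ r) : InjOn (fun ρ => √(ρ ^ 2 - r ^ 2)) (Ioi r) := by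
  intro x hx y hy hxy
  simp only at hxy
  rw [← sqrt_sqrt_sq_add_sq hr hx, ← sqrt_sqrt_sq_add_sq hr hy, hxy]

theorem image_sqrt_sq_sub_sq (hr : 0 ≤ r) : (fun ρ => √(ρ ^ 2 - r ^ 2)) '' Ioi r = Ioi 0 := by
  refine Subset.antisymm ?_ fun a ha => ?_
  · rintro _ ⟨ρ, hρ, rfl⟩
    exact sqrt_sq_sub_sq_pos hr hρ
  · have ha0 : (0 : ℝ) < a := ha
    refine ⟨√(a ^ 2 + r ^ 2), Real.lt_sqrt_of_sq_lt (by nlinarith), ?_⟩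
    simp only
    rw [Real.sq_sqrt (by positivity), add_sub_cancel_right, Real.sqrt_sq ha0.le]

theorem abs_deriv_mul_sqrt_pow {k : ℕ} (hk : 1 ≤ k) (hr : 0 ≤ r) {ρ : ℝ} (hρ : ρ ∈ Ioi r) :
    |ρ / √(ρ ^ 2 - r ^ 2)| * √(ρ ^ 2 - r ^ 2) ^ (k - 1) =
      (ρ ^ 2 - r ^ 2) ^ ((k : ℝ) / 2 - 1) * ρ := by
  have h1 := sqrt_sq_sub_sq_pos hr hρ
  have hρ0 : 0 ≤ ρ := hr.trans (le_of_lt hρ)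
  rw [← sq_rpow_half_sub_one h1 k hk, Real.sq_sqrt (Real.sqrt_pos.1 h1).le,
    abs_of_nonneg (by positivity)]
  field_simp

variable {E : Type*} [NormedAddCommGroup E] [InnerProductSpace ℝ E] [FiniteDimensional ℝ E]
  [MeasurableSpace E] [BorelSpace E] {k : ℕ}

theorem integral_plane (hE : Module.finrank ℝ E = k) (hk : 1 ≤ k) (hr : 0 ≤ r) (F : ℝ → ℂ) :
    ∫ u : E, F (√(‖u‖ ^ 2 + r ^ 2)) = (Real.pi ^ ((k : ℝ) / 2)) • ekMinus ((k : ℝ) / 2) F r := by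
  have : Nontrivial E := Module.nontrivial_of_finrank_pos (R := ℝ) (by omega)
  have h0 : (k : ℝ) * (volume : Measure E).real (Metric.ball 0 1) = sphereArea k := by
    have := congrArg ENNReal.toReal (finrank_mul_volume_ball hE hk)
    rwa [ENNReal.toReal_mul, ENNReal.toReal_natCast, ENNReal.toReal_ofReal
      (sphereArea_pos hk).le] at this
  rw [integral_fun_norm_addHaar volume (fun a => F (√(a ^ 2 + r ^ 2))), hE,
    ← Nat.cast_smul_eq_nsmul ℝ, smul_smul, h0, ← image_sqrt_sq_sub_sq hr,
    integral_image_eq_integral_abs_deriv_smul measurableSet_Ioi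
      (fun ρ hρ => hasDerivWithinAt_sqrt_sq_sub_sq hr hρ) (injOn_sqrt_sq_sub_sq hr), ekMinus,
    smul_smul]
  congr 1
  · rw [sphereArea]
    ring
  · refine setIntegral_congr_fun measurableSet_Ioi fun ρ hρ => ?_
    rw [sqrt_sqrt_sq_add_sq hr hρ, smul_smul, abs_deriv_mul_sqrt_pow hk hr hρ]

theorem integrable_plane_iff (hE : Module.finrank ℝ E = k) (hk : 1 ≤ k) (hr : 0 ≤ r) (F : ℝ → ℂ) :
    Integrable (fun u : E => F (√(‖u‖ ^ 2 + r ^ 2))) ↔ EKMinusExists ((k : ℝ) / 2) F r := by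
  have : Nontrivial E := Module.nontrivial_of_finrank_pos (R := ℝ) (by omega)
  rw [integrable_fun_norm_addHaar volume (f := fun a => F (√(a ^ 2 + r ^ 2))), hE,
    ← image_sqrt_sq_sub_sq hr, integrableOn_image_iff_integrableOn_abs_deriv_smul measurableSet_Ioi
      (fun ρ hρ => hasDerivWithinAt_sqrt_sq_sub_sq hr hρ) (injOn_sqrt_sq_sub_sq hr), EKMinusExists]
  refine integrableOn_congr_fun (fun ρ hρ => ?_) measurableSet_Ioi
  rw [sqrt_sqrt_sq_add_sq hr hρ, smul_smul, abs_deriv_mul_sqrt_pow hk hr hρ]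

/-- Needed because `f₀` is only almost everywhere equal to a Borel function: its composition with
the distance is measurable only if null sets pull back to null sets. -/
theorem measure_plane_eq_zero (hE : Module.finrank ℝ E = k) (hk : 1 ≤ k) (hr : 0 ≤ r) {s : Set ℝ}
    (hs : MeasurableSet s) (h0 : volume.restrict (Ioi 0) s = 0) :
    volume {u : E | √(‖u‖ ^ 2 + r ^ 2) ∈ s} = 0 := by
  have hm : Measurable (s.indicator (1 : ℝ → ENNReal)) := measurable_one.indicator hs
  have h1 := lintegral_fun_norm hE hk (F := fun a => s.indicator (1 : ℝ → ENNReal) (√(a ^ 2 + r ^ 2)))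
    (hm.comp (by fun_prop))
  rw [← image_sqrt_sq_sub_sq hr, lintegral_image_eq_lintegral_abs_deriv_mul measurableSet_Ioi
      (fun ρ hρ => hasDerivWithinAt_sqrt_sq_sub_sq hr hρ) (injOn_sqrt_sq_sub_sq hr)] at h1
  have h2 : ∫⁻ ρ in Ioi r, ENNReal.ofReal |ρ / √(ρ ^ 2 - r ^ 2)| *
      (ENNReal.ofReal (√(ρ ^ 2 - r ^ 2) ^ (k - 1)) *
        s.indicator (1 : ℝ → ENNReal) (√(√(ρ ^ 2 - r ^ 2) ^ 2 + r ^ 2))) = 0 := by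
    refine lintegral_eq_zero_of_ae_eq_zero ?_
    filter_upwards [ae_restrict_mem measurableSet_Ioi,
      ae_restrict_Ioi_mono hr (compl_mem_ae_iff.2 h0)] with ρ hρ hρs
    rw [sqrt_sqrt_sq_add_sq hr hρ, indicator_of_notMem (show ρ ∉ s from hρs)]
    simp
  rw [h2, mul_zero] at h1
  have hms : MeasurableSet {u : E | √(‖u‖ ^ 2 + r ^ 2) ∈ s} :=
    (by fun_prop : Measurable fun u : E => √(‖u‖ ^ 2 + r ^ 2)) hs
  exact (lintegral_indicator_one hms).symm.trans h1

end Plane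

/-! ### The Radon transform of a radial function -/

section Radon

variable {X : Type*} [NormedAddCommGroup X] [InnerProductSpace ℝ X] [FiniteDimensional ℝ X]
  [CompleteSpace X]

/-- Since `u ⟂ ξ`, the foot of `ξ + u + v` is `u` plus the component of `v` orthogonal to `ξ` inside
`ηᗮ`, and these two vectors are orthogonal. -/
theorem dist0_through_lift {j : ℕ} (η : Submodule ℝ X) (ξ : Gr (ηᗮ : Submodule ℝ X) j) (u : η)
    (v : (ηᗮ : Submodule ℝ X)) :
    (AffGr.through ξ.lift ((u : X) + v)).dist0 = √(‖u‖ ^ 2 + ‖ξ.1ᗮ.starProjection v‖ ^ 2) := by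
  have h1 : ξ.lift.1.starProjection ((u : X) + v) = (ξ.1.starProjection v : (ηᗮ : Submodule ℝ X)) := by
    refine Submodule.eq_starProjection_of_mem_orthogonal
      (Submodule.mem_map_of_mem (Submodule.starProjection_apply_mem _ _)) ?_
    rw [Submodule.mem_orthogonal]
    rintro _ ⟨y, hy, rfl⟩
    have h2 := Submodule.inner_right_of_mem_orthogonal hy
      (Submodule.sub_starProjection_mem_orthogonal (K := ξ.1) v)
    rw [Submodule.coe_inner] at h2
    have h3 : inner ℝ (y : X) (u : X) = 0 := Submodule.inner_left_of_mem_orthogonal u.2 y.2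
    rw [add_sub_assoc, inner_add_right]
    simpa [h3] using h2
  have h2 : (AffGr.through ξ.lift ((u : X) + v)).foot =
      (u : X) + (ξ.1ᗮ.starProjection v : (ηᗮ : Submodule ℝ X)) := by
    change ξ.lift.1ᗮ.starProjection ((u : X) + v) = _
    rw [Submodule.starProjection_orthogonal', Submodule.starProjection_orthogonal', sub_apply,
      sub_apply, one_apply_eq_self, one_apply_eq_self, h1, add_sub_assoc]
    rfl
  rw [AffGr.dist0, h2]
  have h3 : inner ℝ (u : X) (ξ.1ᗮ.starProjection v : (ηᗮ : Submodule ℝ X)) = 0 :=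
    Submodule.inner_right_of_mem_orthogonal u.2 (ξ.1ᗮ.starProjection v).2
  refine (Real.sqrt_eq_iff_mul_self_eq ?_ ?_).2 ?_ |>.symm
  · positivity
  · positivity
  · have := norm_add_sq_eq_norm_sq_add_norm_sq_of_inner_eq_zero _ _ h3
    rw [this, Submodule.coe_norm, Submodule.coe_norm]
    ring

variable [MeasurableSpace X] [BorelSpace X]

theorem isProbabilityMeasure_grMeasure {N j : ℕ} (hN : Module.finrank ℝ X = N) (hj : j ≤ N) :
    IsProbabilityMeasure (grMeasure X j) := by
  have h : Nonempty (Gr X j) := nonempty_Gr hN hj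
  rw [grMeasure, dif_pos h]
  exact Measure.isProbabilityMeasure_map (continuous_rotate _).measurable.aemeasurable

theorem distLaw_absolutelyContinuous (N j : ℕ) (s : ℝ) :
    distLaw N j s ≪ volume.restrict (Ioc 0 s) :=
  (withDensity_absolutelyContinuous _ _).trans
    (Measure.restrict_mono Ioo_subset_Ioc_self le_rfl).absolutelyContinuous

end Radon

/-! ### The distance law as an Erdélyi–Kober kernel -/

theorem pi_rpow_mul_distDensity {n j k : ℕ} (hj : 1 ≤ j) (hjk : j + k < n) {s r : ℝ} (hs : 0 < s)
    (hr : 0 < r) : Real.pi ^ ((k : ℝ) / 2) * distDensity (n - k) j s r =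
      cTilde n j k / s ^ ((n : ℤ) - k - 2) * (2 / Real.Gamma ((j : ℝ) / 2)) *
        (((s ^ 2 - r ^ 2) ^ ((j : ℝ) / 2 - 1) * r) * r ^ ((n : ℤ) - j - k - 2)) := by
  obtain ⟨d, rfl⟩ : ∃ d, n = d + 1 + j + k := ⟨n - j - k - 1, by omega⟩
  have e1 : d + 1 + j + k - k = d + 1 + j := by omega
  have e2 : d + 1 + j - j = d + 1 := by omega
  have e3 : (((d + 1 + j + k : ℕ) : ℝ) - k) / 2 = ((d + 1 + j : ℕ) : ℝ) / 2 := by push_cast; ring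
  have e4 : (((d + 1 + j + k : ℕ) : ℝ) - j - k) / 2 = ((d + 1 : ℕ) : ℝ) / 2 := by push_cast; ring
  have e5 : s ^ (((d + 1 + j + k : ℕ) : ℤ) - k - 2) = s ^ (d + 1 + j) / s ^ 2 := by
    rw [← zpow_natCast, ← zpow_natCast, ← zpow_sub₀ hs.ne']
    congr 1
    push_cast
    ring
  have e6 : r ^ (((d + 1 + j + k : ℕ) : ℤ) - j - k - 2) = r ^ (d + 1) / r ^ 2 := by
    rw [← zpow_natCast, ← zpow_natCast, ← zpow_sub₀ hr.ne']
    congr 1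
    push_cast
    ring
  have e7 : Real.pi ^ (((d + 1 + j : ℕ) : ℝ) / 2) =
      Real.pi ^ (((d + 1 : ℕ) : ℝ) / 2) * Real.pi ^ ((j : ℝ) / 2) := by
    rw [← Real.rpow_add Real.pi_pos]
    congr 1
    push_cast
    ring
  have g1 := Real.Gamma_pos_of_pos (show 0 < (j : ℝ) / 2 by positivity)
  have g2 := Real.Gamma_pos_of_pos (show 0 < ((d + 1 : ℕ) : ℝ) / 2 by positivity)
  have g3 := Real.Gamma_pos_of_pos (show 0 < ((d + 1 + j : ℕ) : ℝ) / 2 by positivity)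
  have p1 := Real.rpow_pos_of_pos Real.pi_pos ((j : ℝ) / 2)
  have p2 := Real.rpow_pos_of_pos Real.pi_pos (((d + 1 : ℕ) : ℝ) / 2)
  rw [distDensity, cTilde, e1, e2, e3, e4, e5, e6, sphereArea, sphereArea, sphereArea, e7, inv_pow,
    div_pow]
  field_simp
  ring

theorem integral_distLaw {N j : ℕ} {s : ℝ} (hj : 1 ≤ j) (hjN : j < N) (B : ℝ → ℂ) :
    ∫ r, B r ∂(distLaw N j s) = ∫ r in Ioo 0 s, distDensity N j s r • B r := by
  rw [distLaw, integral_withDensity_eq_integral_toReal_smul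
    (measurable_distDensity N j s).ennreal_ofReal (by simp)]
  refine setIntegral_congr_fun measurableSet_Ioo fun r hr => ?_
  rw [ENNReal.toReal_ofReal (distDensity_nonneg hj hjN hr)]

theorem integrable_distLaw_iff {N j : ℕ} {s : ℝ} (hj : 1 ≤ j) (hjN : j < N) (B : ℝ → ℂ) :
    Integrable B (distLaw N j s) ↔ IntegrableOn (fun r => distDensity N j s r • B r) (Ioo 0 s) := by
  rw [distLaw, integrable_withDensity_iff_integrable_smul'
    (measurable_distDensity N j s).ennreal_ofReal (by simp)]
  refine integrableOn_congr_fun (fun r hr => ?_) measurableSet_Ioo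
  rw [ENNReal.toReal_ofReal (distDensity_nonneg hj hjN hr)]

theorem distDensity_smul_ekMinus {n j k : ℕ} (hj : 1 ≤ j) (hjk : j + k < n) (F : ℝ → ℂ) {s r : ℝ}
    (hs : 0 < s) (hr : 0 < r) :
    distDensity (n - k) j s r • ((Real.pi ^ ((k : ℝ) / 2)) • ekMinus ((k : ℝ) / 2) F r) =
      (cTilde n j k / s ^ ((n : ℤ) - k - 2)) • ((2 / Real.Gamma ((j : ℝ) / 2)) •
        (((s ^ 2 - r ^ 2) ^ ((j : ℝ) / 2 - 1) * r) • innerProfile n j k F r)) := by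
  rw [innerProfile, smul_smul, smul_smul, smul_smul, smul_smul,
    mul_comm _ (Real.pi ^ ((k : ℝ) / 2)), pi_rpow_mul_distDensity hj hjk hs hr]
  ring_nf

theorem integral_distLaw_ekMinus {n j k : ℕ} (hj : 1 ≤ j) (hjk : j + k < n) (F : ℝ → ℂ) {s : ℝ}
    (hs : 0 < s) :
    ∫ r, (Real.pi ^ ((k : ℝ) / 2)) • ekMinus ((k : ℝ) / 2) F r ∂(distLaw (n - k) j s) =
      profile n j k F s := by
  rw [integral_distLaw hj (by omega), setIntegral_congr_fun measurableSet_Ioo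
    fun r hr => distDensity_smul_ekMinus hj hjk F hs hr.1, integral_smul, integral_smul, profile,
    ekPlus, integral_Ioc_eq_integral_Ioo]

theorem integrable_distLaw_ekMinus {n j k : ℕ} (hj : 1 ≤ j) (hjk : j + k < n) {F : ℝ → ℂ} {s : ℝ}
    (hs : 0 < s) (hF : EKPlusExists ((j : ℝ) / 2) (innerProfile n j k F) s) :
    Integrable (fun r => (Real.pi ^ ((k : ℝ) / 2)) • ekMinus ((k : ℝ) / 2) F r)
      (distLaw (n - k) j s) := by
  rw [integrable_distLaw_iff hj (by omega)]
  refine IntegrableOn.congr_fun ?_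
    (fun r hr => (distDensity_smul_ekMinus hj hjk F hs hr.1).symm) measurableSet_Ioo
  have h := IntegrableOn.mono_set hF Ioo_subset_Ioc_self
  exact Integrable.smul (cTilde n j k / s ^ ((n : ℤ) - k - 2))
    (Integrable.smul (2 / Real.Gamma ((j : ℝ) / 2)) h)

/-- Absolute convergence of the Radon integral concerns `I^{k/2}_{-,2} |f₀|`, which is not
controlled by the modulus of `I^{k/2}_{-,2} f₀`. -/
theorem RadialIntegrable.norm {n j k : ℕ} {f₀ : ℝ → ℂ} (H : RadialIntegrable n j k f₀) :
    RadialIntegrable n j k fun r => (‖f₀ r‖ : ℂ) := by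
  have hm : AEStronglyMeasurable (fun r => (‖f₀ r‖ : ℂ)) (volume.restrict (Ioi 0)) :=
    Complex.continuous_ofReal.comp_aestronglyMeasurable H.aesm.norm
  refine ⟨hm, fun S hS => Integrable.mono (H.near S hS) ?_ ?_, fun a ha => Integrable.mono (H.far a ha) ?_ ?_⟩
  · exact (by fun_prop : Measurable fun r : ℝ => r ^ (n - j - 1)).aestronglyMeasurable.smul
      (hm.mono_measure (Measure.restrict_mono Ioc_subset_Ioi_self le_rfl))
  · exact Filter.Eventually.of_forall fun r => by simp
  · exact (by fun_prop : Measurable fun r : ℝ => r ^ (k - 1)).aestronglyMeasurable.smul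
      (hm.mono_measure (Measure.restrict_mono (Ioi_subset_Ioi ha.le) le_rfl))
  · exact Filter.Eventually.of_forall fun r => by simp

theorem RadialIntegrable.aestronglyMeasurable_ekMinus {n j k : ℕ} {f₀ : ℝ → ℂ} (hk : 1 ≤ k)
    (hjk : j + k < n) (H : RadialIntegrable n j k f₀) {s : ℝ} (hs : 0 < s) :
    AEStronglyMeasurable (ekMinus ((k : ℝ) / 2) f₀) (volume.restrict (Ioc 0 s)) := by
  have h1 := aestronglyMeasurable_of_smul measurableSet_Ioc measurable_id (fun r hr => hr.1.ne')
    (H.inner_aux hk hjk hs).2.aestronglyMeasurable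
  exact aestronglyMeasurable_of_smul measurableSet_Ioc (by fun_prop)
    (fun r hr => (zpow_pos hr.1 ((n : ℤ) - j - k - 2)).ne') h1

section Radon

variable {X : Type*} [NormedAddCommGroup X] [InnerProductSpace ℝ X] [FiniteDimensional ℝ X]
  [CompleteSpace X] [MeasurableSpace X] [BorelSpace X]

/-- The inner integral depends on `ξ` only through the distance `q ξ`, so the outer one is an
integral against the law of `q`. Absolute convergence is the same computation for `|f₀|`, combined
with Fubini's criterion. -/
theorem radon_radial {n j k : ℕ} (hn : Module.finrank ℝ X = n) (hj : 1 ≤ j) (hk : 1 ≤ k)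
    (hjk : j + k < n) {f : AffGr X j → ℂ} {f₀ : ℝ → ℂ} (hrad : ∀ τ, f τ = f₀ τ.dist0)
    (H : RadialIntegrable n j k f₀) (ζ : AffGr X k) (hs : 0 < ζ.dist0)
    (hgood : EKPlusExists ((j : ℝ) / 2) (innerProfile n j k fun r => (‖f₀ r‖ : ℂ)) ζ.dist0) :
    RadonExists f ζ ∧ radon f ζ = profile n j k f₀ ζ.dist0 := by
  have hη : Module.finrank ℝ ζ.dir = k := ζ.2.1
  have hY : Module.finrank ℝ (ζ.dirᗮ : Submodule ℝ X) = n - k := by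
    have := ζ.dir.finrank_add_finrank_orthogonal
    omega
  set s := ζ.dist0 with hs_def
  set v : (ζ.dirᗮ : Submodule ℝ X) := ⟨ζ.foot, ζ.2.2⟩ with hv_def
  have hvs : ‖v‖ = s := rfl
  have hv : v ≠ 0 := norm_pos_iff.1 (hvs ▸ hs)
  set q : Gr (ζ.dirᗮ : Submodule ℝ X) j → ℝ := fun ξ => ‖ξ.1ᗮ.starProjection v‖ with hq_def
  have hq0 : ∀ ξ, 0 ≤ q ξ := fun ξ => norm_nonneg _
  have hqm : Measurable q := (continuous_norm_orthogonal_starProjection v).measurable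
  have hlaw : (grMeasure (ζ.dirᗮ : Submodule ℝ X) j).map q = distLaw (n - k) j s :=
    hvs ▸ map_grMeasure hY hj (by omega) hv
  have := isProbabilityMeasure_grMeasure hY (show j ≤ n - k by omega)
  have hfq : ∀ (ξ : Gr (ζ.dirᗮ : Submodule ℝ X) j) (u : ζ.dir),
      f (AffGr.through ξ.lift ((u : X) + ζ.foot)) = f₀ (√(‖u‖ ^ 2 + q ξ ^ 2)) := by
    intro ξ u
    rw [hrad]
    exact congrArg f₀ (dist0_through_lift ζ.dir ξ u v)
  have hac : (grMeasure (ζ.dirᗮ : Submodule ℝ X) j).map q ≪ volume.restrict (Ioc 0 s) :=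
    hlaw ▸ distLaw_absolutelyContinuous _ _ _
  have hac' : (grMeasure (ζ.dirᗮ : Submodule ℝ X) j).map q ≪ volume.restrict (Ioi 0) :=
    hac.trans (Measure.restrict_mono Ioc_subset_Ioi_self le_rfl).absolutelyContinuous
  set T : Gr (ζ.dirᗮ : Submodule ℝ X) j × ζ.dir → ℝ := fun p => √(‖p.2‖ ^ 2 + q p.1 ^ 2) with hT_def
  have hTm : Measurable T := by
    have h1 : Measurable fun p : Gr (ζ.dirᗮ : Submodule ℝ X) j × ζ.dir => q p.1 :=
      hqm.comp measurable_fst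
    simp only [hT_def]
    fun_prop
  have hTq : Measure.QuasiMeasurePreserving T
      ((grMeasure (ζ.dirᗮ : Submodule ℝ X) j).prod volume) (volume.restrict (Ioi 0)) := by
    refine ⟨hTm, Measure.AbsolutelyContinuous.mk fun t ht h0 => ?_⟩
    rw [Measure.map_apply hTm ht, Measure.measure_prod_null (hTm ht)]
    exact Filter.Eventually.of_forall fun ξ => measure_plane_eq_zero hη hk (hq0 ξ) ht h0
  have hhm : AEStronglyMeasurable (fun p => f₀ (T p))
      ((grMeasure (ζ.dirᗮ : Submodule ℝ X) j).prod volume) :=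
    H.aesm.comp_quasiMeasurePreserving hTq
  have hAm : ∀ {g₀ : ℝ → ℂ}, RadialIntegrable n j k g₀ → AEStronglyMeasurable
      (fun r => (Real.pi ^ ((k : ℝ) / 2)) • ekMinus ((k : ℝ) / 2) g₀ r)
      ((grMeasure (ζ.dirᗮ : Submodule ℝ X) j).map q) := fun hg =>
    ((hg.aestronglyMeasurable_ekMinus hk hjk hs).mono_ac hac).const_smul
      (Real.pi ^ ((k : ℝ) / 2))
  constructor
  · rw [RadonExists]
    simp_rw [hfq]
    refine (integrable_prod_iff hhm).2 ⟨?_, ?_⟩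
    · have h1 : ∀ᵐ ξ ∂(grMeasure (ζ.dirᗮ : Submodule ℝ X) j),
          EKMinusExists ((k : ℝ) / 2) f₀ (q ξ) :=
        ae_of_ae_map hqm.aemeasurable (hac'.ae_le (H.ae_ekMinusExists hk hjk))
      filter_upwards [h1] with ξ hξ
      exact (integrable_plane_iff hη hk (hq0 ξ) f₀).2 hξ
    · have h1 := integrable_distLaw_ekMinus hj hjk hs hgood
      rw [← hlaw, integrable_map_measure (hAm H.norm) hqm.aemeasurable] at h1
      refine (h1.norm).congr (Filter.Eventually.of_forall fun ξ => ?_)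
      simp only [Function.comp_apply]
      rw [← integral_plane hη hk (hq0 ξ), integral_complex_ofReal, Complex.norm_real,
        Real.norm_of_nonneg (integral_nonneg fun u => norm_nonneg _)]
  · rw [radon]
    simp_rw [hfq]
    -- Valid for every `ξ`: where the integral over `u` diverges, both sides have the default value
    -- zero.
    simp_rw [integral_plane hη hk (hq0 _)]
    rw [← integral_distLaw_ekMinus hj hjk f₀ hs, ← hlaw, integral_map hqm.aemeasurable (hAm H)]

end Radon

end MixedRadon

end

/-! ### The theorem for Euclidean space -/

theorem mainTheorem7 (n j k : ℕ) (hj : 1 ≤ j) (hk : 1 ≤ k) (hjk : j + k < n)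
    (f : MixedRadon.AffGr (EuclideanSpace ℝ (Fin n)) j → ℂ) (f₀ : ℝ → ℂ)
    (hrad : ∀ τ, f τ = f₀ τ.dist0)
    (hloc : LocallyIntegrable f (MixedRadon.affGrMeasure (EuclideanSpace ℝ (Fin n)) j))
    (hex : ∃ a : ℝ, 0 < a ∧
      IntegrableOn (fun τ => ‖f τ‖ * τ.dist0 ^ ((k : ℤ) + j - n)) {τ | a < τ.dist0}
        (MixedRadon.affGrMeasure (EuclideanSpace ℝ (Fin n)) j)) :
    -- the Radon transform of `f` exists almost everywhere and is the radial function `I_{j,k} f₀`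
    (∀ᵐ ζ ∂(MixedRadon.affGrMeasure (EuclideanSpace ℝ (Fin n)) k),
      MixedRadon.RadonExists f ζ ∧
      MixedRadon.radon f ζ = MixedRadon.profile n j k f₀ ζ.dist0) ∧
    -- the fractional integrals in `I_{j,k} f₀` exist almost everywhere
    (∀ᵐ r : ℝ ∂(volume.restrict (Ioi 0)), MixedRadon.EKMinusExists ((k : ℝ) / 2) f₀ r) ∧
    (∀ᵐ s : ℝ ∂(volume.restrict (Ioi 0)),
      MixedRadon.EKPlusExists ((j : ℝ) / 2) (MixedRadon.innerProfile n j k f₀) s) ∧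
    -- the fractional derivatives in the inversion formula exist almost everywhere
    MixedRadon.EKDerivPlusExists ((j : ℝ) / 2) (MixedRadon.stepOne n j k f₀) ∧
    MixedRadon.EKDerivMinusExists ((k : ℝ) / 2) (MixedRadon.stepTwo n j k f₀) ∧
    -- the inversion formula
    (∀ᵐ t : ℝ ∂(volume.restrict (Ioi 0)),
      f₀ t = (MixedRadon.cTilde n j k)⁻¹ •
        MixedRadon.ekDerivMinus ((k : ℝ) / 2)
          (fun r => (r ^ (2 - (n : ℤ) + j + k)) •
            MixedRadon.ekDerivPlus ((j : ℝ) / 2)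
              (fun s => (s ^ ((n : ℤ) - k - 2)) • MixedRadon.profile n j k f₀ s) r) t) := by
  have hn : Module.finrank ℝ (EuclideanSpace ℝ (Fin n)) = n := finrank_euclideanSpace_fin
  have H := MixedRadon.radialIntegrable_of_affGr hn hk hjk hrad hloc hex
  have hM := H.minus_part hj hk hjk
  refine ⟨?_, H.ae_ekMinusExists hk hjk, H.ae_ekPlusExists hj hk hjk, (H.plus_part hj hk hjk).1,
    hM.1, ?_⟩
  · have h1 := (MixedRadon.quasiMeasurePreserving_dist0 (j := k) hn (by omega)).ae
      ((H.norm.ae_ekPlusExists hj hk hjk).and (ae_restrict_mem measurableSet_Ioi))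
    filter_upwards [h1] with ζ hζ
    exact MixedRadon.radon_radial hn hj hk hjk hrad H ζ hζ.2 hζ.1
  · filter_upwards [hM.2] with t ht
    -- `stepOne` and `stepTwo` unfold to the functions nested in the inversion formula.
    refine Eq.symm (Eq.trans (congrArg _ ht) ?_)
    rw [inv_smul_smul₀ (MixedRadon.cTilde_pos hjk).ne']
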